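/- Fix $d\in\mathbb N$. Let $\emptyset\neq\Omega_g\subsetneq[0,1]^d$ be open and path connected with Lipschitz boundary, and suppose that $\partial\Omega_g$ and $\Omega_w:=\mathbb R^d\setminus(\Omega_g+\mathbb Z^d)$ are path connected. For $x,y\in\mathbb R^d$ let $\mathscr A(x,y)$ be the set of Lipschitz curves $u:[0,1]\to\mathbb R^d$ with $u(0)=x$, $u(1)=y$, and for $E\subset\mathbb R^d$ and $\beta>0$ put $$d_E(x,y;\beta):=\inf\Big\{\int_0^1\beta\|u'(\tau)\|\,d\tau : u\in\mathscr A(x,y),\ u(\tau)\in E\ \text{for all } \tau\in(0,1)\Big\}\in[0,\infty].$$ Assume that $\Omega_g$ has a high opacity coefficient, that is, a number $\lambda\in(0,\infty)$ such that $d_{\partial\Omega_g}(x,y;1)<d_{\Omega_g}(x,y;\beta)$ for all $x\neq y$ in $\partial\Omega_g$ and all $\beta>\lambda$. Fix $\beta>\lambda$. For $\varepsilon>0$ and $p\in[1,\infty]$ let $a_{p,\varepsilon}(x):=1$ for $x\in\Omega_w$ and, for $x\in\Omega_g+\mathbb Z^d$, $a_{p,\varepsilon}(x):=\beta\varepsilon^{-p}$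 if $p<\infty$ and $a_{\infty,\varepsilon}(x):=+\infty$. Put $$F_{p,\varepsilon}(u):=\int_0^1a_{p,\varepsilon}\Big(\frac{u(\tau)}{\varepsilon}\Big)\|u'(\tau)\|\,d\tau\in[0,\infty],\qquad d_{p,\varepsilon}(x,y):=\inf_{u\in\mathscr A(x,y)}F_{p,\varepsilon}(u)$$ (with $\infty\cdot 0=0$). **Theorem.** Let $p\in[1,\infty]$, and suppose that $\xi_2:=(1/2,\dots,1/2)\in\Omega_g$ and $\xi_1:=0\in\Omega_w$. Then $\lim_{\varepsilon\to0^+}d_{p,\varepsilon}(\xi_1,\xi_2)$ does not exist in $[0,\infty]$. More precisely, the limits $M:=\lim_{k\to\infty}d_{p,1/(2k)}(\xi_1,\xi_2)$ and $L:=\lim_{k\to\infty}d_{p,1/(2k+1)}(\xi_1,\xi_2)$ exist in $[0,\infty]$ and $M<L$. Consequently $F_{p,\varepsilon}$ does not $\Gamma$-converge on $\mathscr A(\xi_1,\xi_2)$ with respect to uniform convergence as $\varepsilon\to0^+$: there is no $G:\mathscr A(\xi_1,\xi_2)\to[0,\infty]$ such that, for every sequence $\varepsilon_k>0$ with $\varepsilon_k\to0$,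 the functionals $F_{p,\varepsilon_k}$ $\Gamma$-converge to $G$. -/

import Mathlib

open Set Filter Topology MeasureTheory
open scoped ENNReal NNReal

noncomputable section

/-- Euclidean space `ℝ^d`. -/
abbrev Euc (d : ℕ) : Type := EuclideanSpace ℝ (Fin d)

/-- The vector of `ℝ^d` with the integer coordinates `z`. -/
def latticeVec {d : ℕ} (z : Fin d → ℤ) : Euc d := WithLp.toLp 2 (fun i => (z i : ℝ))

/-- The closed unit cube `[0,1]^d`. -/
def unitCube (d : ℕ) : Set (Euc d) := {x | ∀ i, x i ∈ Icc (0 : ℝ) 1}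

/-- The centre `(1/2, …, 1/2)` of the unit cube. -/
def cubeCentre (d : ℕ) : Euc d := WithLp.toLp 2 (fun _ => (1 / 2 : ℝ))

/-- The periodic set `Ω + ℤ^d`. -/
def periodize {d : ℕ} (Ω : Set (Euc d)) : Set (Euc d) :=
  {x | ∃ z : Fin d → ℤ, x - latticeVec z ∈ Ω}

/-- `Ω_w`, the complement of `Ω + ℤ^d`. -/
def whiteSet {d : ℕ} (Ω : Set (Euc d)) : Set (Euc d) := (periodize Ω)ᶜ

/-- `Ω` has a Lipschitz boundary: near each boundary point, and up to the choice of a direction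
`n` (the last coordinate axis), `Ω` is the strict epigraph of a Lipschitz function of the
remaining coordinates. -/
def HasLipschitzBoundary {d : ℕ} (Ω : Set (Euc d)) : Prop :=
  ∀ x ∈ frontier Ω, ∃ r : ℝ, 0 < r ∧ ∃ n : Euc d, ‖n‖ = 1 ∧
    ∃ (K : ℝ≥0) (γ : (Submodule.span ℝ {n})ᗮ → ℝ), LipschitzWith K γ ∧
      ∀ y ∈ Metric.ball x r,
        (y ∈ Ω ↔ γ ((Submodule.span ℝ {n})ᗮ.orthogonalProjectionOnto y) < inner ℝ n y)

/-- Admissible inclusions. -/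
structure IsAdmissibleInclusion {d : ℕ} (Ω : Set (Euc d)) : Prop where
  nonempty : Ω.Nonempty
  ssubset_unitCube : Ω ⊂ unitCube d
  isOpen : IsOpen Ω
  isPathConnected : IsPathConnected Ω
  hasLipschitzBoundary : HasLipschitzBoundary Ω
  isPathConnected_whiteSet : IsPathConnected (whiteSet Ω)
  isPathConnected_frontier : IsPathConnected (frontier Ω)

/-- `𝒜(x,y)`: the Lipschitz curves `u : [0,1] → ℝ^d` with `u 0 = x` and `u 1 = y`. A Lipschitz
curve on `(0,1)` is identified with its continuous extension to `[0,1]`. As a subtype of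
`C([0,1], ℝ^d)` this space carries the metric of uniform convergence, i.e. the `L^∞` metric. -/
def CurveSpace {d : ℕ} (x y : Euc d) : Type :=
  {u : C(unitInterval, Euc d) // (∃ K : ℝ≥0, LipschitzWith K u) ∧ u 0 = x ∧ u 1 = y}

instance {d : ℕ} (x y : Euc d) : MetricSpace (CurveSpace x y) :=
  inferInstanceAs (MetricSpace
    {u : C(unitInterval, Euc d) // (∃ K : ℝ≥0, LipschitzWith K u) ∧ u 0 = x ∧ u 1 = y})

/-- The curve as a function of a real parameter (only its values on `[0,1]` matter; it is
extended by constants). -/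
def CurveSpace.fn {d : ℕ} {x y : Euc d} (u : CurveSpace x y) : ℝ → Euc d :=
  Set.IccExtend (zero_le_one' ℝ) (fun t : Icc (0 : ℝ) 1 => u.1 t)

/-- The weighted length `∫₀¹ w(u(τ)) ‖u'(τ)‖ dτ` in `[0,∞]`. The derivative exists for almost
every `τ`, since `u` is Lipschitz; the convention `∞ · 0 = 0` is in force. -/
def weightedLength {d : ℕ} (w : Euc d → ℝ≥0∞) {x y : Euc d} (u : CurveSpace x y) : ℝ≥0∞ :=
  ∫⁻ τ in Ioo (0 : ℝ) 1, w (u.fn τ) * ‖deriv u.fn τ‖ₑ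

/-- `d_E(x,y;β)`: the infimum of `∫₀¹ β ‖u'‖` over the curves `u ∈ 𝒜(x,y)` with `u(τ) ∈ E` for
all `τ ∈ (0,1)`; it is `∞` if there is no such curve. -/
def constrainedDist {d : ℕ} (E : Set (Euc d)) (β : ℝ) (x y : Euc d) : ℝ≥0∞ :=
  ⨅ (u : CurveSpace x y) (_ : ∀ τ ∈ Ioo (0 : ℝ) 1, u.fn τ ∈ E),
    weightedLength (fun _ => ENNReal.ofReal β) u

/-- `lam` is a high opacity coefficient for `Ω`: for every `β > lam`, two distinct boundary points
are joined more cheaply along the boundary than through `Ω` with weight `β`. (For `x = y` both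
distances vanish.) -/
def IsHighOpacityCoefficient {d : ℕ} (Ω : Set (Euc d)) (lam : ℝ) : Prop :=
  0 < lam ∧ ∀ x ∈ frontier Ω, ∀ y ∈ frontier Ω, x ≠ y → ∀ β : ℝ, lam < β →
    constrainedDist (frontier Ω) 1 x y < constrainedDist Ω β x y

open Classical in
/-- The metric coefficient `a_{p,ε}`: on `Ω + ℤ^d` it is `β ε^{-p}` for `p < ∞` and `∞` for
`p = ∞`; elsewhere it is `1`. -/
def metricCoeff {d : ℕ} (Ω : Set (Euc d)) (β : ℝ) (p : ℝ≥0∞) (ε : ℝ) (x : Euc d) : ℝ≥0∞ :=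
  if x ∈ periodize Ω then
    (if p = ⊤ then ⊤ else ENNReal.ofReal (β * ε ^ (-p.toReal)))
  else 1

/-- `F_{p,ε}(u) = ∫₀¹ a_{p,ε}(u/ε) ‖u'‖ dτ`. -/
def lengthFunctional {d : ℕ} (Ω : Set (Euc d)) (β : ℝ) (p : ℝ≥0∞) (ε : ℝ) {x y : Euc d}
    (u : CurveSpace x y) : ℝ≥0∞ :=
  weightedLength (fun v => metricCoeff Ω β p ε (ε⁻¹ • v)) u

/-- The induced distance `d_{p,ε}(x,y)`, the minimal value of `F_{p,ε}` on `𝒜(x,y)`. -/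
def inducedDist {d : ℕ} (Ω : Set (Euc d)) (β : ℝ) (p : ℝ≥0∞) (ε : ℝ) (x y : Euc d) : ℝ≥0∞ :=
  ⨅ u : CurveSpace x y, lengthFunctional Ω β p ε u

/-- `Γ`-convergence of a sequence of `[0,∞]`-valued functionals on a metric space: the liminf
inequality and the existence of recovery sequences, at every point. -/
def SeqGammaConverges {X : Type*} [MetricSpace X] (F : ℕ → X → ℝ≥0∞) (G : X → ℝ≥0∞) : Prop :=
  ∀ u : X,
    (∀ v : ℕ → X, Tendsto v atTop (𝓝 u) → G u ≤ liminf (fun k => F k (v k)) atTop) ∧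
    (∃ v : ℕ → X, Tendsto v atTop (𝓝 u) ∧ limsup (fun k => F k (v k)) atTop ≤ G u)

/-- `Γ`-convergence of a family `(F_ε)_{ε > 0}` as `ε → 0`: along every sequence of positive
numbers tending to `0`, with the same limit. -/
def GammaConvergesAtZero {X : Type*} [MetricSpace X] (F : ℝ → X → ℝ≥0∞) (G : X → ℝ≥0∞) : Prop :=
  ∀ ε : ℕ → ℝ, (∀ k, 0 < ε k) → Tendsto ε atTop (𝓝 0) → SeqGammaConverges (fun k => F (ε k)) G

end

/-! Dividing curves by `ε` turns `d_{p,ε}(0,y)` into `ε` times a distance for a weight of period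
one, equal to `1` on white points and to `t = β ε^{-p}` (or `∞`) on black ones. The target becomes
`ξ₂/ε`. For `ε = 1/(2k)` this is the white lattice point `(k,…,k)`; for `ε = 1/(2k+1)` it is a
translate of the cell centre, which is black. The two subsequences differ by the cost of getting
into the last cell.

Between white points the value of `t ≥ β` is irrelevant: every excursion into a cell is replaced by
a cheaper path on the cell's boundary, which is white (`exists_white_curve`,
`weightDist_blackWeight_eq`). Thus the even values are `diagDist Ω β k / (2k)`, which converge to
`m/2` by subadditivity.

For a black target, a curve is cut at its last entrance into the final cell
(`exists_last_entrance`). With `ρ` the distance from the centre to `∂Ω`, the cost in the unscaled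
lattice is `diagDist Ω β k + t ρ` up to an error at most `β√d` (`weightDist_centre_ge`,
`weightDist_centre_le`). After multiplication by `ε` the error vanishes and the extra term is `β ρ
ε^{1-p}`: it equals `βρ > 0` for `p = 1` and diverges for `p > 1`. Hence `M < L`.

A common `Γ`-limit would be at least `L` everywhere, by recovery sequences along the odd values.
Along the even values there are uniformly Lipschitz near minimizers, because white curves can be run
at bounded speed. Arzelà–Ascoli and the liminf inequality then give a curve at which the `Γ`-limit
is at most `M`, a contradiction. -/

section

variable {d : ℕ}

/-! ### Weighted length of arcs and the induced distance -/

/-- The weighted length of the arc `f` over the parameter interval `(a, b)`. -/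
noncomputable def arcCost (w : Euc d → ℝ≥0∞) (f : ℝ → Euc d) (a b : ℝ) : ℝ≥0∞ :=
  ∫⁻ τ in Ioo a b, w (f τ) * ‖deriv f τ‖ₑ

/-- The distance induced by the weight `w`. -/
noncomputable def weightDist (w : Euc d → ℝ≥0∞) (x y : Euc d) : ℝ≥0∞ :=
  ⨅ u : CurveSpace x y, weightedLength w u

/-- The displacement of a Lipschitz arc is at most its length. -/
theorem enorm_sub_le_lintegral_deriv {f : ℝ → Euc d} {K : ℝ≥0} (hf : LipschitzWith K f)
    {a b : ℝ} (hab : a ≤ b) : ‖f b - f a‖ₑ ≤ ∫⁻ τ in Ioo a b, ‖deriv f τ‖ₑ := by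
  set n : Euc d := f b - f a with hn
  rcases eq_or_ne n 0 with h0 | h0
  · simp [h0]
  -- Pairing with the displacement `n` itself reduces the claim to the scalar fundamental theorem of
  -- calculus; one factor `‖n‖` is cancelled at the end.
  have hg : LipschitzWith (‖n‖₊ * K) (fun t => inner ℝ n (f t)) := by
    have h1 : LipschitzWith ‖innerSL ℝ n‖₊ (innerSL ℝ n) := (innerSL ℝ n).lipschitz
    have h2 : ‖innerSL ℝ n‖₊ = ‖n‖₊ := by
      ext; simp
    rw [h2] at h1
    exact h1.comp hf
  have hint := (hg.lipschitzOnWith (s := uIcc a b)).absolutelyContinuousOnInterval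
  have hval : ∫ x in a..b, deriv (fun t => inner ℝ n (f t)) x = ‖n‖ ^ 2 := by
    rw [hint.integral_deriv_eq_sub, ← inner_sub_right, ← hn, real_inner_self_eq_norm_sq]
  have hae : ∀ᵐ x, ‖deriv (fun t => inner ℝ n (f t)) x‖ₑ ≤ ‖n‖ₑ * ‖deriv f x‖ₑ := by
    filter_upwards [hf.ae_differentiableAt_real] with x hx
    have h1 : HasDerivAt (fun t => inner ℝ n (f t)) (inner ℝ n (deriv f x)) x := by
      simpa using (hasDerivAt_const x n).inner ℝ hx.hasDerivAt
    rw [h1.deriv, ← enorm_norm n, ← enorm_norm (deriv f x), ← enorm_mul]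
    rw [enorm_le_iff_norm_le, norm_mul, norm_norm, norm_norm]
    exact abs_real_inner_le_norm _ _
  have h3 : ‖n‖ₑ * ‖n‖ₑ ≤ ‖n‖ₑ * ∫⁻ τ in Ioo a b, ‖deriv f τ‖ₑ := by
    calc ‖n‖ₑ * ‖n‖ₑ = ‖‖n‖ ^ 2‖ₑ := by rw [pow_two, enorm_mul, enorm_norm]
      _ = ‖∫ x in Ioo a b, deriv (fun t => inner ℝ n (f t)) x‖ₑ := by
          rw [← hval, intervalIntegral.integral_of_le hab, integral_Ioc_eq_integral_Ioo]
      _ ≤ ∫⁻ x in Ioo a b, ‖deriv (fun t => inner ℝ n (f t)) x‖ₑ :=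
          enorm_integral_le_lintegral_enorm _
      _ ≤ ∫⁻ x in Ioo a b, ‖n‖ₑ * ‖deriv f x‖ₑ :=
          lintegral_mono_ae (ae_restrict_of_ae hae)
      _ = _ := lintegral_const_mul' _ _ enorm_ne_top
  exact (ENNReal.mul_le_mul_iff_right (by simpa using h0) enorm_ne_top).1 h3

theorem enorm_deriv_le {f : ℝ → Euc d} {K : ℝ≥0} (hf : LipschitzWith K f) (t : ℝ) :
    ‖deriv f t‖ₑ ≤ K := by
  have := norm_deriv_le_of_lipschitz (x₀ := t) hf
  rw [← ofReal_norm, ← ENNReal.ofReal_coe_nnreal]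
  exact ENNReal.ofReal_le_ofReal this

namespace CurveSpace

variable {x y : Euc d} (u : CurveSpace x y)

theorem exists_lipschitzWith_fn : ∃ K : ℝ≥0, LipschitzWith K u.fn := by
  obtain ⟨K, hK⟩ := u.2.1
  refine ⟨K, ?_⟩
  have := hK.comp (LipschitzWith.projIcc (zero_le_one' ℝ))
  rwa [mul_one] at this

theorem fn_of_le_zero {t : ℝ} (ht : t ≤ 0) : u.fn t = x := by
  rw [fn, IccExtend_of_le_left _ _ ht]
  exact u.2.2.1

theorem fn_of_one_le {t : ℝ} (ht : 1 ≤ t) : u.fn t = y := by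
  rw [fn, IccExtend_of_right_le _ _ ht]
  exact u.2.2.2

theorem fn_zero : u.fn 0 = x := u.fn_of_le_zero le_rfl

theorem fn_one : u.fn 1 = y := u.fn_of_one_le le_rfl

/-- The restriction to `[0,1]` of a Lipschitz function of a real variable. -/
def ofLipschitz (f : ℝ → Euc d) (hf : ∃ K : ℝ≥0, LipschitzWith K f) (h0 : f 0 = x)
    (h1 : f 1 = y) : CurveSpace x y :=
  ⟨⟨fun t => f t, (hf.choose_spec.continuous).comp continuous_subtype_val⟩,
    ⟨hf.choose, fun s t => hf.choose_spec s t⟩, by simpa using h0, by simpa using h1⟩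

theorem ofLipschitz_fn {f : ℝ → Euc d} (hf : ∃ K : ℝ≥0, LipschitzWith K f) (h0 : f 0 = x)
    (h1 : f 1 = y) {t : ℝ} (ht : t ∈ Icc (0 : ℝ) 1) : (ofLipschitz f hf h0 h1).fn t = f t := by
  rw [fn, IccExtend_of_mem _ _ ht]
  rfl

end CurveSpace

theorem arcCost_congr {w : Euc d → ℝ≥0∞} {f g : ℝ → Euc d} {a b : ℝ}
    (h : ∀ t ∈ Ioo a b, f t = g t) : arcCost w f a b = arcCost w g a b := by
  refine setLIntegral_congr_fun measurableSet_Ioo fun t ht => ?_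
  have : f =ᶠ[𝓝 t] g := by
    filter_upwards [isOpen_Ioo.mem_nhds ht] with s hs using h s hs
  simp only [this.deriv_eq, h t ht]

theorem weightedLength_eq_arcCost {w : Euc d → ℝ≥0∞} {x y : Euc d} (u : CurveSpace x y) :
    weightedLength w u = arcCost w u.fn 0 1 := rfl

theorem weightedLength_ofLipschitz {w : Euc d → ℝ≥0∞} {x y : Euc d} {f : ℝ → Euc d}
    (hf : ∃ K : ℝ≥0, LipschitzWith K f) (h0 : f 0 = x) (h1 : f 1 = y) :
    weightedLength w (CurveSpace.ofLipschitz f hf h0 h1) = arcCost w f 0 1 :=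
  arcCost_congr fun _ ht => CurveSpace.ofLipschitz_fn hf h0 h1 (Ioo_subset_Icc_self ht)

theorem arcCost_add {w : Euc d → ℝ≥0∞} {f : ℝ → Euc d} {a b c : ℝ} (hab : a ≤ b)
    (hbc : b ≤ c) : arcCost w f a b + arcCost w f b c = arcCost w f a c := by
  simp only [arcCost, Measure.restrict_congr_set (μ := (volume : Measure ℝ)) Ioo_ae_eq_Ioc]
  rw [← lintegral_union measurableSet_Ioc (Ioc_disjoint_Ioc_of_le le_rfl),
    Ioc_union_Ioc_eq_Ioc hab hbc]

theorem arcCost_mono {w w' : Euc d → ℝ≥0∞} {f : ℝ → Euc d} {a b : ℝ}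
    (h : ∀ t ∈ Ioo a b, w (f t) ≤ w' (f t)) : arcCost w f a b ≤ arcCost w' f a b :=
  setLIntegral_mono' measurableSet_Ioo fun t ht => mul_le_mul_left (h t ht) _

theorem arcCost_const_mul_le {w : Euc d → ℝ≥0∞} {f : ℝ → Euc d} {K : ℝ≥0}
    (hf : LipschitzWith K f) {a b : ℝ} (hab : a ≤ b) {t : ℝ≥0∞}
    (h : ∀ τ ∈ Ioo a b, t ≤ w (f τ)) : t * ‖f b - f a‖ₑ ≤ arcCost w f a b := by
  calc t * ‖f b - f a‖ₑ ≤ t * ∫⁻ τ in Ioo a b, ‖deriv f τ‖ₑ := by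
        gcongr; exact enorm_sub_le_lintegral_deriv hf hab
    _ ≤ ∫⁻ τ in Ioo a b, t * ‖deriv f τ‖ₑ := lintegral_const_mul_le _ _
    _ ≤ _ := arcCost_mono (w := fun _ => t) h

theorem arcCost_le_of_lipschitz {w : Euc d → ℝ≥0∞} {f : ℝ → Euc d} {K : ℝ≥0}
    (hf : LipschitzWith K f) {a b : ℝ} {t : ℝ≥0∞}
    (h : ∀ τ ∈ Ioo a b, w (f τ) ≤ t) :
    arcCost w f a b ≤ t * K * ENNReal.ofReal (b - a) := by
  calc arcCost w f a b ≤ ∫⁻ _ in Ioo a b, t * K :=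
        setLIntegral_mono' measurableSet_Ioo fun τ hτ =>
          mul_le_mul' (h τ hτ) (enorm_deriv_le hf τ)
    _ = _ := by simp

/-- Affine change of parameter. -/
theorem arcCost_comp_affine {w : Euc d → ℝ≥0∞} {f : ℝ → Euc d}
    {m c a b : ℝ} (hm : 0 ≤ m) :
    arcCost w (fun τ => f (m * τ + c)) a b = arcCost w f (m * a + c) (m * b + c) := by
  rcases hm.eq_or_lt with rfl | hm
  · simp [arcCost]
  have himg : (fun τ => m * τ + c) '' Ioo a b = Ioo (m * a + c) (m * b + c) := by
    rw [image_affine_Ioo hm]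
  have hd : ∀ τ : ℝ, deriv (fun τ => f (m * τ + c)) τ = m • deriv f (m * τ + c) := by
    intro τ
    have h1 := deriv_comp_mul_left (c := m) (f := fun s => f (s + c)) (x := τ)
    rw [h1, deriv_comp_add_const]
  rw [arcCost, arcCost, ← himg,
    lintegral_image_eq_lintegral_abs_deriv_mul (f' := fun _ => m) measurableSet_Ioo]
  · refine lintegral_congr fun τ => ?_
    rw [hd, enorm_smul, abs_of_pos hm, Real.enorm_eq_ofReal hm.le]
    ring
  · intro τ _
    simpa using (((hasDerivAt_id τ).const_mul m).add_const c).hasDerivWithinAt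
  · intro s _ t _ h
    simpa [hm.ne'] using h

theorem lipschitz_affine {f : ℝ → Euc d} {K : ℝ≥0} (hf : LipschitzWith K f) (m c : ℝ) :
    LipschitzWith (K * ‖m‖₊) (fun τ => f (m * τ + c)) := by
  refine hf.comp (LipschitzWith.of_dist_le_mul fun s t => ?_)
  simp only [Real.dist_eq, coe_nnnorm, Real.norm_eq_abs, ← abs_mul]
  apply le_of_eq; congr 1; ring

theorem weightDist_le_arcCost {w : Euc d → ℝ≥0∞} {f : ℝ → Euc d} {K : ℝ≥0}
    (hf : LipschitzWith K f) {a b : ℝ} (hab : a ≤ b) :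
    weightDist w (f a) (f b) ≤ arcCost w f a b := by
  have hL : ∃ K : ℝ≥0, LipschitzWith K (fun τ => f ((b - a) * τ + a)) :=
    ⟨_, lipschitz_affine hf _ _⟩
  refine (iInf_le _ (CurveSpace.ofLipschitz _ hL (by simp) (by simp))).trans ?_
  rw [weightedLength_ofLipschitz, arcCost_comp_affine (by linarith)]
  simp

theorem weightDist_mono {w w' : Euc d → ℝ≥0∞} (h : ∀ v, w v ≤ w' v) (x y : Euc d) :
    weightDist w x y ≤ weightDist w' x y :=
  iInf_mono fun _ => arcCost_mono fun _ _ => h _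

theorem weightDist_le_of_segment {w : Euc d → ℝ≥0∞} {x y : Euc d} {t : ℝ≥0∞}
    (h : ∀ v, w v ≤ t) : weightDist w x y ≤ t * ‖y - x‖ₑ := by
  have hL : LipschitzWith ‖y - x‖₊ (fun τ : ℝ => x + τ • (y - x)) := by
    refine LipschitzWith.of_dist_le_mul fun s t => ?_
    rw [dist_add_left, dist_eq_norm, ← sub_smul, norm_smul, mul_comm]
    rfl
  have h1 := weightDist_le_arcCost (w := w) hL zero_le_one
  simp only [zero_smul, add_zero, one_smul, add_sub_cancel] at h1
  refine h1.trans ((arcCost_le_of_lipschitz hL fun _ _ => h _).trans ?_)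
  simp [enorm_eq_nnnorm]

theorem weightDist_triangle (w : Euc d → ℝ≥0∞) (x y z : Euc d) :
    weightDist w x z ≤ weightDist w x y + weightDist w y z := by
  refine ENNReal.le_iInf_add_iInf fun u v => ?_
  obtain ⟨K, hK⟩ := u.exists_lipschitzWith_fn
  obtain ⟨K', hK'⟩ := v.exists_lipschitzWith_fn
  -- Concatenation without gluing: as both curves are extended by constants, on each half of `[0,1]`
  -- one of the two summands equals `y` and cancels.
  set h : ℝ → Euc d := fun τ => u.fn (2 * τ + 0) + v.fn (2 * τ + (-1)) - y with hh
  have hL : LipschitzWith _ h :=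
    ((lipschitz_affine hK 2 0).add (lipschitz_affine hK' 2 (-1))).sub (LipschitzWith.const y)
  have e1 : ∀ τ ∈ Ioo (0 : ℝ) (1 / 2), h τ = u.fn (2 * τ + 0) := by
    intro τ hτ
    simp only [hh]
    rw [v.fn_of_le_zero (by linarith [hτ.2])]
    abel
  have e2 : ∀ τ ∈ Ioo (1 / 2 : ℝ) 1, h τ = v.fn (2 * τ + (-1)) := by
    intro τ hτ
    simp only [hh]
    rw [u.fn_of_one_le (by linarith [hτ.1])]
    abel
  have h0 : h 0 = x := by
    simp only [hh]
    rw [v.fn_of_le_zero (by norm_num), u.fn_of_le_zero (by norm_num)]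
    abel
  have h1 : h 1 = z := by
    simp only [hh]
    rw [v.fn_of_one_le (by norm_num), u.fn_of_one_le (by norm_num)]
    abel
  have := weightDist_le_arcCost (w := w) hL zero_le_one
  rw [h0, h1] at this
  refine this.trans ?_
  rw [← arcCost_add (b := 1 / 2) (by norm_num) (by norm_num), arcCost_congr e1,
    arcCost_congr e2, arcCost_comp_affine zero_le_two, arcCost_comp_affine zero_le_two]
  norm_num [weightedLength_eq_arcCost]

theorem weightDist_add_right_le {w : Euc d → ℝ≥0∞} {z : Euc d} (hz : ∀ v, w (v + z) = w v)
    (x y : Euc d) : weightDist w (x + z) (y + z) ≤ weightDist w x y := by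
  refine le_iInf fun u => ?_
  obtain ⟨K, hK⟩ := u.exists_lipschitzWith_fn
  have hL : LipschitzWith (K + 0) (fun τ => u.fn τ + z) := hK.add (LipschitzWith.const z)
  have h1 := weightDist_le_arcCost (w := w) hL zero_le_one
  rw [u.fn_zero, u.fn_one] at h1
  refine h1.trans (le_of_eq ?_)
  rw [weightedLength_eq_arcCost]
  simp only [arcCost, hz, deriv_add_const]

theorem arcCost_const_smul (w : Euc d → ℝ≥0∞) (f : ℝ → Euc d) (a b : ℝ) {c : ℝ} (hc : 0 < c) :
    arcCost w (fun τ => c • f τ) a b = ENNReal.ofReal c * arcCost (fun v => w (c • v)) f a b := by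
  rw [arcCost, arcCost, ← lintegral_const_mul' _ _ ENNReal.ofReal_ne_top]
  refine lintegral_congr fun τ => ?_
  rw [deriv_fun_const_smul_field, enorm_smul, Real.enorm_eq_ofReal hc.le]
  ring

theorem weightDist_smul_le (w : Euc d → ℝ≥0∞) (x y : Euc d) {c : ℝ} (hc : 0 < c) :
    weightDist w (c • x) (c • y) ≤ ENNReal.ofReal c * weightDist (fun v => w (c • v)) x y := by
  rw [weightDist, weightDist, ENNReal.mul_iInf_of_ne (by simpa using hc) ENNReal.ofReal_ne_top]
  refine le_iInf fun u => ?_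
  obtain ⟨K, hK⟩ := u.exists_lipschitzWith_fn
  have hL : LipschitzWith (‖c‖₊ * K) (fun τ => c • u.fn τ) := (lipschitzWith_smul c).comp hK
  have h1 := weightDist_le_arcCost (w := w) hL zero_le_one
  rw [u.fn_zero, u.fn_one, arcCost_const_smul w _ _ _ hc] at h1
  exact h1

theorem weightDist_smul (w : Euc d → ℝ≥0∞) (x y : Euc d) {c : ℝ} (hc : 0 < c) :
    weightDist w (c • x) (c • y) = ENNReal.ofReal c * weightDist (fun v => w (c • v)) x y := by
  refine le_antisymm (weightDist_smul_le w x y hc) ?_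
  have h := weightDist_smul_le (fun v => w (c • v)) (c • x) (c • y) (inv_pos.2 hc)
  simp only [smul_smul, inv_mul_cancel₀ hc.ne', mul_inv_cancel₀ hc.ne', one_smul] at h
  calc _ ≤ ENNReal.ofReal c * (ENNReal.ofReal c⁻¹ * weightDist w (c • x) (c • y)) := by gcongr
    _ = _ := by
      rw [← mul_assoc, ← ENNReal.ofReal_mul hc.le, mul_inv_cancel₀ hc.ne', ENNReal.ofReal_one,
        one_mul]

/-! ### The periodic black and white weight and its cells -/

open Classical in
/-- The periodic weight equal to `t` on `Ω + ℤ^d` and to `1` elsewhere. -/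
noncomputable def blackWeight (Ω : Set (Euc d)) (t : ℝ≥0∞) (x : Euc d) : ℝ≥0∞ :=
  if x ∈ periodize Ω then t else 1

theorem blackWeight_of_mem {Ω : Set (Euc d)} {t : ℝ≥0∞} {x : Euc d} (h : x ∈ periodize Ω) :
    blackWeight Ω t x = t := if_pos h

theorem blackWeight_of_mem_whiteSet {Ω : Set (Euc d)} {t : ℝ≥0∞} {x : Euc d}
    (h : x ∈ whiteSet Ω) : blackWeight Ω t x = 1 := if_neg h

theorem blackWeight_mono {Ω : Set (Euc d)} {s t : ℝ≥0∞} (h : s ≤ t) (x : Euc d) :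
    blackWeight Ω s x ≤ blackWeight Ω t x := by
  unfold blackWeight; split_ifs <;> simp [h]

theorem one_le_blackWeight {Ω : Set (Euc d)} {t : ℝ≥0∞} (h : 1 ≤ t) (x : Euc d) :
    1 ≤ blackWeight Ω t x := by
  unfold blackWeight; split_ifs <;> simp [h]

theorem blackWeight_le {Ω : Set (Euc d)} {t : ℝ≥0∞} (h : 1 ≤ t) (x : Euc d) :
    blackWeight Ω t x ≤ t := by
  unfold blackWeight; split_ifs <;> simp [h]

theorem latticeVec_add (z z' : Fin d → ℤ) :
    latticeVec (z + z') = latticeVec z + latticeVec z' := by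
  ext i; simp [latticeVec]

theorem latticeVec_neg (z : Fin d → ℤ) : latticeVec (-z) = -latticeVec z := by
  ext i; simp [latticeVec]

theorem add_latticeVec_mem_periodize {Ω : Set (Euc d)} {x : Euc d} (z : Fin d → ℤ) :
    x + latticeVec z ∈ periodize Ω ↔ x ∈ periodize Ω := by
  constructor
  · rintro ⟨z', h⟩
    refine ⟨z' - z, ?_⟩
    rw [sub_eq_add_neg z', latticeVec_add, latticeVec_neg]
    convert h using 1; abel
  · rintro ⟨z', h⟩
    refine ⟨z' + z, ?_⟩
    rw [latticeVec_add]
    convert h using 1; abel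

theorem add_latticeVec_mem_whiteSet {Ω : Set (Euc d)} {x : Euc d} (z : Fin d → ℤ) :
    x + latticeVec z ∈ whiteSet Ω ↔ x ∈ whiteSet Ω :=
  not_congr (add_latticeVec_mem_periodize z)

theorem blackWeight_add_latticeVec (Ω : Set (Euc d)) (t : ℝ≥0∞) (x : Euc d) (z : Fin d → ℤ) :
    blackWeight Ω t (x + latticeVec z) = blackWeight Ω t x := by
  classical
  exact if_congr (add_latticeVec_mem_periodize z) rfl rfl

theorem isOpen_cell {Ω : Set (Euc d)} (ho : IsOpen Ω) (z : Fin d → ℤ) :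
    IsOpen {x : Euc d | x - latticeVec z ∈ Ω} :=
  ho.preimage (continuous_id.sub continuous_const)

theorem isOpen_periodize {Ω : Set (Euc d)} (ho : IsOpen Ω) : IsOpen (periodize Ω) := by
  have : periodize Ω = ⋃ z : Fin d → ℤ, {x : Euc d | x - latticeVec z ∈ Ω} := by
    ext x; simp [periodize]
  rw [this]
  exact isOpen_iUnion fun z => isOpen_cell ho z

/-- Coordinate projections are open maps, so the image of `Ω` is an open subset of `[0,1]`. This is
what makes distinct translates of `Ω` disjoint. -/
theorem coord_mem_Ioo {Ω : Set (Euc d)} (ho : IsOpen Ω) (hc : Ω ⊆ unitCube d) {x : Euc d}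
    (hx : x ∈ Ω) (i : Fin d) : x i ∈ Ioo (0 : ℝ) 1 := by
  have hsurj : Function.Surjective (EuclideanSpace.proj i : Euc d →L[ℝ] ℝ) := fun r =>
    ⟨WithLp.toLp 2 (fun _ => r), rfl⟩
  have h1 := (EuclideanSpace.proj i : Euc d →L[ℝ] ℝ).isOpenMap hsurj Ω ho
  have h2 : (EuclideanSpace.proj i : Euc d →L[ℝ] ℝ) '' Ω ⊆ Icc 0 1 := by
    rintro _ ⟨y, hy, rfl⟩
    exact hc hy i
  have h3 := interior_maximal h2 h1 ⟨x, hx, rfl⟩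
  rwa [interior_Icc] at h3

theorem cell_unique {Ω : Set (Euc d)} (ho : IsOpen Ω) (hc : Ω ⊆ unitCube d) {x : Euc d}
    {z z' : Fin d → ℤ} (h : x - latticeVec z ∈ Ω) (h' : x - latticeVec z' ∈ Ω) : z = z' := by
  ext i
  have h1 := coord_mem_Ioo ho hc h i
  have h2 := coord_mem_Ioo ho hc h' i
  simp only [latticeVec, PiLp.sub_apply, mem_Ioo] at h1 h2
  have e1 : (z i : ℝ) < z' i + 1 := by linarith
  have e2 : (z' i : ℝ) < z i + 1 := by linarith
  have e1' : z i < z' i + 1 := by exact_mod_cast e1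
  have e2' : z' i < z i + 1 := by exact_mod_cast e2
  omega

/-- If such a point lay in some open cell, that cell would meet the cell `z`, hence be equal to it;
but an open set misses its own frontier. Detours along the boundary therefore have weight `1`. -/
theorem mem_whiteSet_of_mem_frontier {Ω : Set (Euc d)} (ho : IsOpen Ω) (hc : Ω ⊆ unitCube d)
    {x : Euc d} {z : Fin d → ℤ} (h : x - latticeVec z ∈ frontier Ω) : x ∈ whiteSet Ω := by
  rintro ⟨z', hz'⟩
  rw [ho.frontier_eq] at h
  have hopen : IsOpen {y : Euc d | y + latticeVec z - latticeVec z' ∈ Ω} :=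
    ho.preimage ((continuous_id.add continuous_const).sub continuous_const)
  obtain ⟨y, hy, hy'⟩ := mem_closure_iff.1 h.1 _ hopen (by simpa using hz')
  have : z = z' := cell_unique (x := y + latticeVec z) ho hc (by simpa using hy') hy
  subst this
  exact h.2 hz'

theorem mem_frontier_of_left {Ω : Set (Euc d)} (ho : IsOpen Ω) {f : ℝ → Euc d}
    (hf : Continuous f) {a b : ℝ} (hab : a < b) (h : ∀ τ ∈ Ioo a b, f τ ∈ Ω) (ha : f a ∉ Ω) :
    f a ∈ frontier Ω := by
  rw [ho.frontier_eq]
  refine ⟨?_, ha⟩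
  have h1 : a ∈ closure (Ioo a b) := by
    rw [closure_Ioo hab.ne]; exact left_mem_Icc.2 hab.le
  exact map_mem_closure hf h1 h

theorem mem_frontier_of_right {Ω : Set (Euc d)} (ho : IsOpen Ω) {f : ℝ → Euc d}
    (hf : Continuous f) {a b : ℝ} (hab : a < b) (h : ∀ τ ∈ Ioo a b, f τ ∈ Ω) (hb : f b ∉ Ω) :
    f b ∈ frontier Ω := by
  rw [ho.frontier_eq]
  refine ⟨?_, hb⟩
  have h1 : b ∈ closure (Ioo a b) := by
    rw [closure_Ioo hab.ne]; exact right_mem_Icc.2 hab.le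
  exact map_mem_closure hf h1 h

/-- A connected piece of a curve inside `Ω + ℤ^d` stays in one cell. -/
theorem exists_cell_of_excursion {Ω : Set (Euc d)} (ho : IsOpen Ω) (hc : Ω ⊆ unitCube d)
    {f : ℝ → Euc d} (hf : Continuous f) {s : Set ℝ} (hs : IsPreconnected s) {τ₀ : ℝ}
    (hτ₀ : τ₀ ∈ s) (h : ∀ τ ∈ s, f τ ∈ periodize Ω) :
    ∃ z : Fin d → ℤ, ∀ τ ∈ s, f τ - latticeVec z ∈ Ω := by
  obtain ⟨z, hz⟩ := h _ hτ₀
  refine ⟨z, ?_⟩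
  have hU : IsOpen (f ⁻¹' {x | x - latticeVec z ∈ Ω}) := (isOpen_cell ho z).preimage hf
  have hV : IsOpen (f ⁻¹' ⋃ (z' : Fin d → ℤ) (_ : z' ≠ z), {x | x - latticeVec z' ∈ Ω}) :=
    (isOpen_iUnion fun z' => isOpen_iUnion fun _ => isOpen_cell ho z').preimage hf
  refine hs.subset_left_of_subset_union hU hV ?_ ?_ ⟨τ₀, hτ₀, hz⟩
  · refine Set.disjoint_left.2 fun τ h1 h2 => ?_
    simp only [mem_preimage, mem_iUnion] at h2
    obtain ⟨z', hne, h2⟩ := h2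
    exact hne (cell_unique ho hc h2 h1)
  · intro τ hτ
    obtain ⟨z', hz'⟩ := h τ hτ
    by_cases hzz : z' = z
    · subst hzz; exact Or.inl hz'
    · refine Or.inr ?_
      simp only [mem_preimage, mem_iUnion]
      exact ⟨z', hzz, hz'⟩

/-! ### Parametrization by weighted arc length -/

/-- A curve whose displacements are controlled by the increments of `S` can be parametrized
by the values of `S`. -/
theorem exists_lipschitz_reparam {E : Type*} [MetricSpace E] {w : ℝ → E} {S : ℝ → ℝ} {a b : ℝ}
    (hab : a ≤ b) (hS : ContinuousOn S (Icc a b))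
    (h : ∀ s ∈ Icc a b, ∀ t ∈ Icc a b, s ≤ t → dist (w s) (w t) ≤ S t - S s) :
    ∃ g : ℝ → E, LipschitzWith 1 g ∧ (∀ σ ≤ S a, g σ = w a) ∧ (∀ σ, S b ≤ σ → g σ = w b) ∧
      ∀ σ, g σ ∈ w '' Icc a b := by
  have hle : S a ≤ S b := by
    have := h a (left_mem_Icc.2 hab) b (right_mem_Icc.2 hab) hab
    linarith [dist_nonneg (x := w a) (y := w b)]
  have hd : ∀ s ∈ Icc a b, ∀ t ∈ Icc a b, dist (w s) (w t) ≤ |S s - S t| := by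
    intro s hs t ht
    rcases le_total s t with hst | hst
    · exact (h s hs t ht hst).trans (by rw [abs_sub_comm]; exact le_abs_self _)
    · rw [dist_comm]; exact (h t ht s hs hst).trans (le_abs_self _)
  -- Clamping `σ` makes `g` constant outside `[S a, S b]`. By `hd`, `w` is constant on level sets of
  -- `S`, so the choice of preimage is harmless.
  have hex : ∀ σ : ℝ, ∃ τ ∈ Icc a b, S τ = projIcc (S a) (S b) hle σ := fun σ =>
    intermediate_value_Icc hab hS (projIcc (S a) (S b) hle σ).2
  choose r hr hSr using hex
  refine ⟨fun σ => w (r σ), ?_, ?_, ?_, fun σ => ⟨_, hr σ, rfl⟩⟩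
  · refine LipschitzWith.of_dist_le_mul fun σ σ' => ?_
    refine (hd _ (hr σ) _ (hr σ')).trans ?_
    rw [hSr, hSr]
    exact (LipschitzWith.projIcc hle).dist_le_mul σ σ'
  · intro σ hσ
    have := hd _ (hr σ) _ (left_mem_Icc.2 hab)
    rw [hSr, projIcc_of_le_left hle hσ] at this
    simpa using this
  · intro σ hσ
    have := hd _ (hr σ) _ (right_mem_Icc.2 hab)
    rw [hSr, projIcc_of_right_le hle hσ] at this
    simpa using this

/-- The weighted arc length from the parameter `0`. -/
noncomputable def arcLength (w : Euc d → ℝ≥0∞) (f : ℝ → Euc d) (τ : ℝ) : ℝ :=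
  (arcCost w f 0 τ).toReal

section arcLength

variable {w : Euc d → ℝ≥0∞} {f : ℝ → Euc d} {K t : ℝ≥0}

theorem arcCost_ne_top (hf : LipschitzWith K f) (hw : ∀ v, w v ≤ t) (a b : ℝ) :
    arcCost w f a b ≠ ⊤ :=
  ne_top_of_le_ne_top (by finiteness) (arcCost_le_of_lipschitz hf fun _ _ => hw _)

theorem arcLength_zero : arcLength w f 0 = 0 := by simp [arcLength, arcCost]

theorem arcLength_sub (hf : LipschitzWith K f) (hw : ∀ v, w v ≤ t) {a b : ℝ} (ha : 0 ≤ a)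
    (hab : a ≤ b) : arcLength w f b - arcLength w f a = (arcCost w f a b).toReal := by
  rw [arcLength, arcLength, ← arcCost_add ha hab,
    ENNReal.toReal_add (arcCost_ne_top hf hw _ _) (arcCost_ne_top hf hw _ _)]
  ring

theorem dist_le_arcLength_sub (hf : LipschitzWith K f) (hw : ∀ v, w v ≤ t) {a b : ℝ}
    (ha : 0 ≤ a) (hab : a ≤ b) (h1 : ∀ τ ∈ Ioo a b, 1 ≤ w (f τ)) :
    dist (f a) (f b) ≤ arcLength w f b - arcLength w f a := by
  rw [arcLength_sub hf hw ha hab, dist_comm, dist_eq_norm]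
  have := arcCost_const_mul_le hf hab h1
  rw [one_mul] at this
  have := ENNReal.toReal_mono (arcCost_ne_top hf hw _ _) this
  rwa [toReal_enorm] at this

theorem continuousOn_arcLength (hf : LipschitzWith K f) (hw : ∀ v, w v ≤ t) :
    ContinuousOn (arcLength w f) (Ici 0) := by
  have key : ∀ a b : ℝ, 0 ≤ a → a ≤ b →
      |arcLength w f b - arcLength w f a| ≤ (t * K : ℝ≥0) * (b - a) := by
    intro a b ha hab
    rw [arcLength_sub hf hw ha hab, abs_of_nonneg ENNReal.toReal_nonneg]
    have := ENNReal.toReal_mono (by finiteness)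
      (arcCost_le_of_lipschitz hf (a := a) (b := b) fun _ _ => hw _)
    refine this.trans (le_of_eq ?_)
    simp [ENNReal.toReal_ofReal (sub_nonneg.2 hab)]
  have : LipschitzOnWith (t * K) (arcLength w f) (Ici 0) := by
    refine LipschitzOnWith.of_dist_le_mul fun a ha b hb => ?_
    rcases le_total a b with hab | hab
    · rw [dist_comm, dist_comm a b, Real.dist_eq, Real.dist_eq, abs_of_nonneg (sub_nonneg.2 hab)]
      exact key a b ha hab
    · rw [Real.dist_eq, Real.dist_eq, abs_of_nonneg (sub_nonneg.2 hab)]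
      exact key b a hb hab
  exact this.continuousOn

end arcLength

/-- Parametrization of a curve by its arc length. -/
theorem exists_unitSpeed {x y : Euc d} (u : CurveSpace x y) :
    ∃ g : ℝ → Euc d, LipschitzWith 1 g ∧ (∀ σ ≤ 0, g σ = x) ∧
      (∀ σ, (weightedLength (fun _ => 1) u).toReal ≤ σ → g σ = y) ∧
      ∀ σ, g σ ∈ u.fn '' Icc 0 1 := by
  obtain ⟨K, hK⟩ := u.exists_lipschitzWith_fn
  have hw : ∀ v : Euc d, (fun _ : Euc d => (1 : ℝ≥0∞)) v ≤ (1 : ℝ≥0) := fun _ => by simp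
  obtain ⟨g, h1, h2, h3, h4⟩ := exists_lipschitz_reparam (w := u.fn) zero_le_one
    ((continuousOn_arcLength hK hw).mono Icc_subset_Ici_self)
    (fun s hs t _ hst => dist_le_arcLength_sub hK hw hs.1 hst fun _ _ => le_rfl)
  rw [u.fn_zero, arcLength_zero] at h2
  rw [u.fn_one] at h3
  exact ⟨g, h1, h2, h3, h4⟩

theorem constrainedDist_le_arcCost {E : Set (Euc d)} {β : ℝ} {f : ℝ → Euc d} {K : ℝ≥0}
    (hf : LipschitzWith K f) {a b : ℝ} (hab : a < b) (h : ∀ τ ∈ Ioo a b, f τ ∈ E) :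
    constrainedDist E β (f a) (f b) ≤ arcCost (fun _ => ENNReal.ofReal β) f a b := by
  have hL : ∃ K : ℝ≥0, LipschitzWith K (fun τ => f ((b - a) * τ + a)) :=
    ⟨_, lipschitz_affine hf _ _⟩
  refine (iInf₂_le (CurveSpace.ofLipschitz _ hL (by simp) (by simp)) ?_).trans ?_
  · intro τ hτ
    rw [CurveSpace.ofLipschitz_fn hL _ _ (Ioo_subset_Icc_self hτ)]
    refine h _ ⟨?_, ?_⟩
    · nlinarith [hτ.1, hτ.2]
    · nlinarith [hτ.1, hτ.2]
  · rw [weightedLength_ofLipschitz, arcCost_comp_affine (by linarith)]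
    simp

/-! ### Replacing black excursions by boundary detours -/

/-- The strict comparison of boundary and interior distances for one coefficient `β`. -/
def BoundaryCheaper (Ω : Set (Euc d)) (β : ℝ) : Prop :=
  ∀ x ∈ frontier Ω, ∀ y ∈ frontier Ω, x ≠ y →
    constrainedDist (frontier Ω) 1 x y < constrainedDist Ω β x y

/-- A detour along the boundary that replaces an excursion into `Ω + ℤ^d`. -/
theorem exists_detour {Ω : Set (Euc d)} (ho : IsOpen Ω) (hc : Ω ⊆ unitCube d) {β : ℝ}
    (hβ : 1 < β) (hΩ : BoundaryCheaper Ω β) {f : ℝ → Euc d} {K : ℝ≥0} (hf : LipschitzWith K f)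
    {a b : ℝ} (h0 : 0 ≤ a) (hab : a ≤ b) (ha : f a ∈ whiteSet Ω) (hb : f b ∈ whiteSet Ω)
    (h : ∀ τ ∈ Ioo a b, f τ ∈ periodize Ω) :
    ∃ g : ℝ → Euc d, LipschitzWith 1 g ∧
      g (arcLength (blackWeight Ω (ENNReal.ofReal β)) f a) = f a ∧
      g (arcLength (blackWeight Ω (ENNReal.ofReal β)) f b) = f b ∧ ∀ σ, g σ ∈ whiteSet Ω := by
  -- The comparison of distances covers distinct boundary points only; a closed excursion is
  -- replaced by standing still.
  by_cases hfab : f a = f b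
  · exact ⟨fun _ => f a, (LipschitzWith.const _).weaken zero_le_one, rfl, hfab, fun _ => ha⟩
  have hab' : a < b := hab.lt_of_ne fun e => hfab (e ▸ rfl)
  obtain ⟨z, hz⟩ := exists_cell_of_excursion ho hc hf.continuous isPreconnected_Ioo
    (τ₀ := (a + b) / 2) ⟨by linarith, by linarith⟩ h
  have hg : LipschitzWith (K + 0) (fun τ => f τ - latticeVec z) := hf.sub (LipschitzWith.const _)
  have hga := mem_frontier_of_left ho hg.continuous hab' hz fun h' => ha ⟨z, h'⟩
  have hgb := mem_frontier_of_right ho hg.continuous hab' hz fun h' => hb ⟨z, h'⟩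
  have hlt := (hΩ _ hga _ hgb (by simpa using hfab)).trans_le
    (constrainedDist_le_arcCost hg hab' hz)
  have hcost : arcCost (fun _ => ENNReal.ofReal β) (fun τ => f τ - latticeVec z) a b =
      arcCost (blackWeight Ω (ENNReal.ofReal β)) f a b := by
    refine setLIntegral_congr_fun measurableSet_Ioo fun τ hτ => ?_
    simp only [blackWeight_of_mem (h τ hτ), deriv_sub_const]
  rw [hcost] at hlt
  have hw : ∀ v, blackWeight Ω (ENNReal.ofReal β) v ≤ (Real.toNNReal β : ℝ≥0) := fun v =>
    blackWeight_le (by simpa using hβ.le) v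
  obtain ⟨u, hu⟩ := iInf_lt_iff.1 hlt
  obtain ⟨hmem, hu⟩ := iInf_lt_iff.1 hu
  rw [ENNReal.ofReal_one] at hu
  obtain ⟨g, g1, g2, g3, g4⟩ := exists_unitSpeed u
  -- The detour runs at speed at most one and is shorter than the weighted excursion, so it arrives
  -- by the time `S b` at which the original curve returns, and waits there.
  have hle : (weightedLength (fun _ => 1) u).toReal ≤
      arcLength (blackWeight Ω (ENNReal.ofReal β)) f b -
        arcLength (blackWeight Ω (ENNReal.ofReal β)) f a := by
    rw [arcLength_sub hf hw h0 hab]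
    exact ENNReal.toReal_mono (arcCost_ne_top hf hw _ _) hu.le
  refine ⟨fun σ => g (σ - arcLength (blackWeight Ω (ENNReal.ofReal β)) f a) + latticeVec z,
    ?_, ?_, ?_, ?_⟩
  · refine LipschitzWith.of_dist_le_mul fun σ σ' => ?_
    rw [dist_add_right]
    refine (g1.dist_le_mul _ _).trans (le_of_eq ?_)
    rw [dist_sub_right]
  · simp [g2]
  · simp [g3 _ hle]
  · intro σ
    refine mem_whiteSet_of_mem_frontier ho hc (z := z) ?_
    rw [add_sub_cancel_right]
    obtain ⟨τ, hτ, hτe⟩ := g4 (σ - arcLength (blackWeight Ω (ENNReal.ofReal β)) f a)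
    rw [← hτe]
    rcases hτ.1.eq_or_lt with rfl | h0
    · rwa [u.fn_zero]
    rcases hτ.2.eq_or_lt with rfl | h1
    · rwa [u.fn_one]
    exact hmem τ ⟨h0, h1⟩

theorem IsClosed.exists_isGreatest_inter_Iic {C : Set ℝ} (hC : IsClosed C) {s τ : ℝ}
    (hs : s ∈ C) (hsτ : s ≤ τ) : ∃ a, IsGreatest (C ∩ Iic τ) a := by
  have hne : (C ∩ Iic τ).Nonempty := ⟨s, hs, hsτ⟩
  have hb : BddAbove (C ∩ Iic τ) := ⟨τ, fun _ h => h.2⟩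
  exact ⟨_, (hC.inter isClosed_Iic).csSup_mem hne hb, fun _ h => le_csSup hb h⟩

theorem IsClosed.exists_isLeast_inter_Ici {C : Set ℝ} (hC : IsClosed C) {s τ : ℝ}
    (hs : s ∈ C) (hsτ : τ ≤ s) : ∃ a, IsLeast (C ∩ Ici τ) a := by
  have hne : (C ∩ Ici τ).Nonempty := ⟨s, hs, hsτ⟩
  have hb : BddBelow (C ∩ Ici τ) := ⟨τ, fun _ h => h.2⟩
  exact ⟨_, (hC.inter isClosed_Ici).csInf_mem hne hb, fun _ h => csInf_le hb h⟩

theorem isClosed_whiteSet {Ω : Set (Euc d)} (ho : IsOpen Ω) : IsClosed (whiteSet Ω) :=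
  (isOpen_periodize ho).isClosed_compl

/-- A curve between white points is dominated by a white curve of no greater length. -/
theorem exists_white_curve {Ω : Set (Euc d)} (ho : IsOpen Ω) (hc : Ω ⊆ unitCube d) {β : ℝ}
    (hβ : 1 < β) (hΩ : BoundaryCheaper Ω β) {x y : Euc d} (hx : x ∈ whiteSet Ω)
    (hy : y ∈ whiteSet Ω) (u : CurveSpace x y) :
    ∃ g : ℝ → Euc d,
      LipschitzWith (weightedLength (blackWeight Ω (ENNReal.ofReal β)) u).toNNReal g ∧
      g 0 = x ∧ g 1 = y ∧ ∀ τ, g τ ∈ whiteSet Ω := by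
  obtain ⟨K, hK⟩ := u.exists_lipschitzWith_fn
  set w := blackWeight Ω (ENNReal.ofReal β) with hw
  have hwle : ∀ v, w v ≤ (Real.toNNReal β : ℝ≥0) := fun v =>
    blackWeight_le (by simpa using hβ.le) v
  have hw1 : ∀ v, 1 ≤ w v := one_le_blackWeight (by simpa using hβ.le)
  set S := arcLength w u.fn with hS
  set C : Set ℝ := {τ | u.fn τ ∈ whiteSet Ω} with hC
  have hCc : IsClosed C := (isClosed_whiteSet ho).preimage hK.continuous
  have h0C : (0 : ℝ) ∈ C := by simpa [hC, u.fn_zero] using hx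
  have h1C : (1 : ℝ) ∈ C := by simpa [hC, u.fn_one] using hy
  -- The premises stand inside the existential so that `choose` fixes one detour per pair `(a, b)`:
  -- all parameters in one black gap follow the same detour. This treats all gaps at once, however
  -- many there are.
  have hH : ∀ a b : ℝ, ∃ g : ℝ → Euc d, 0 ≤ a → a ≤ b → a ∈ C → b ∈ C →
      (∀ τ ∈ Ioo a b, τ ∉ C) → LipschitzWith 1 g ∧ g (S a) = u.fn a ∧ g (S b) = u.fn b ∧
        ∀ σ, g σ ∈ whiteSet Ω := by
    intro a b
    by_cases h : 0 ≤ a ∧ a ≤ b ∧ a ∈ C ∧ b ∈ C ∧ ∀ τ ∈ Ioo a b, τ ∉ C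
    · obtain ⟨h1, h2, h3, h4, h5⟩ := h
      obtain ⟨g, hg⟩ := exists_detour ho hc hβ hΩ hK h1 h2 h3 h4
        (fun τ hτ => not_not.1 (h5 τ hτ))
      exact ⟨g, fun _ _ _ _ _ => hg⟩
    · exact ⟨fun _ => 0, fun h1 h2 h3 h4 h5 => absurd ⟨h1, h2, h3, h4, h5⟩ h⟩
  choose H hH using hH
  have hA : ∀ τ : ℝ, ∃ a, τ ∈ Icc (0 : ℝ) 1 → IsGreatest (C ∩ Iic τ) a := fun τ => by
    by_cases h : τ ∈ Icc (0 : ℝ) 1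
    · obtain ⟨a, ha⟩ := hCc.exists_isGreatest_inter_Iic h0C h.1
      exact ⟨a, fun _ => ha⟩
    · exact ⟨0, fun h' => absurd h' h⟩
  have hB : ∀ τ : ℝ, ∃ a, τ ∈ Icc (0 : ℝ) 1 → IsLeast (C ∩ Ici τ) a := fun τ => by
    by_cases h : τ ∈ Icc (0 : ℝ) 1
    · obtain ⟨a, ha⟩ := hCc.exists_isLeast_inter_Ici h1C h.2
      exact ⟨a, fun _ => ha⟩
    · exact ⟨0, fun h' => absurd h' h⟩
  choose A hA using hA
  choose B hB using hB
  have hHτ : ∀ τ ∈ Icc (0 : ℝ) 1, LipschitzWith 1 (H (A τ) (B τ)) ∧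
      H (A τ) (B τ) (S (A τ)) = u.fn (A τ) ∧ H (A τ) (B τ) (S (B τ)) = u.fn (B τ) ∧
      ∀ σ, H (A τ) (B τ) σ ∈ whiteSet Ω := by
    intro τ hτ
    have ha := hA τ hτ
    have hb := hB τ hτ
    refine hH _ _ (ha.2 ⟨h0C, hτ.1⟩) (ha.1.2.trans hb.1.2) ha.1.1 hb.1.1 ?_
    intro σ hσ hσC
    rcases le_total σ τ with h | h
    · exact absurd (ha.2 ⟨hσC, h⟩) (not_le.2 hσ.1)
    · exact absurd (hb.2 ⟨hσC, h⟩) (not_le.2 hσ.2)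
  have hSmono : ∀ s t : ℝ, 0 ≤ s → s ≤ t → S s ≤ S t := fun s t hs hst => by
    have := dist_le_arcLength_sub hK hwle hs hst fun _ _ => hw1 _
    linarith [dist_nonneg (x := u.fn s) (y := u.fn t)]
  -- `A τ` and `B τ` are the nearest white parameters on either side of `τ`; `W` follows the detour
  -- of that gap on the arc-length clock `S`.
  set W : ℝ → Euc d := fun τ => H (A τ) (B τ) (S τ) with hW
  have hWd : ∀ s ∈ Icc (0 : ℝ) 1, ∀ t ∈ Icc (0 : ℝ) 1, s ≤ t →
      dist (W s) (W t) ≤ S t - S s := by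
    intro s hs t ht hst
    obtain ⟨s1, s2, s3, s4⟩ := hHτ s hs
    obtain ⟨t1, t2, t3, t4⟩ := hHτ t ht
    have as := hA s hs
    have bs := hB s hs
    have at' := hA t ht
    have bt := hB t ht
    -- Either a white parameter separates `s` from `t`, and the path passes through `B s` and `A t`,
    -- or both lie in one gap and share a detour.
    rcases le_or_gt (B s) (A t) with h | h
    · have e1 : dist (W s) (u.fn (B s)) ≤ S (B s) - S s := by
        rw [← s3]
        refine (s1.dist_le_mul _ _).trans (le_of_eq ?_)
        rw [NNReal.coe_one, one_mul, dist_comm, Real.dist_eq,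
          abs_of_nonneg (sub_nonneg.2 (hSmono _ _ hs.1 bs.1.2))]
      have e2 : dist (u.fn (A t)) (W t) ≤ S t - S (A t) := by
        rw [← t2]
        refine (t1.dist_le_mul _ _).trans (le_of_eq ?_)
        rw [NNReal.coe_one, one_mul, dist_comm, Real.dist_eq,
          abs_of_nonneg (sub_nonneg.2 (hSmono _ _ (at'.2 ⟨h0C, ht.1⟩) at'.1.2))]
      have e3 : dist (u.fn (B s)) (u.fn (A t)) ≤ S (A t) - S (B s) :=
        dist_le_arcLength_sub hK hwle (hs.1.trans bs.1.2) h fun _ _ => hw1 _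
      linarith [dist_triangle4 (W s) (u.fn (B s)) (u.fn (A t)) (W t)]
    · have eA : A t = A s := by
        refine le_antisymm (as.2 ⟨at'.1.1, ?_⟩) (at'.2 ⟨as.1.1, as.1.2.trans hst⟩)
        by_contra hcon
        exact absurd (bs.2 ⟨at'.1.1, show s ≤ A t from le_of_not_ge hcon⟩) (not_le.2 h)
      have eB : B t = B s := by
        refine le_antisymm (bt.2 ⟨bs.1.1, ?_⟩) (bs.2 ⟨bt.1.1, hst.trans bt.1.2⟩)
        by_contra hcon
        exact absurd (at'.2 ⟨bs.1.1, show B s ≤ t from le_of_not_ge hcon⟩) (not_le.2 h)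
      simp only [hW, eA, eB]
      refine (s1.dist_le_mul _ _).trans (le_of_eq ?_)
      rw [NNReal.coe_one, one_mul, dist_comm, Real.dist_eq,
        abs_of_nonneg (sub_nonneg.2 (hSmono _ _ hs.1 hst))]
  have hWC : ∀ τ ∈ Icc (0 : ℝ) 1, τ ∈ C → W τ = u.fn τ := by
    intro τ hτ hτC
    have ha := hA τ hτ
    have e : A τ = τ := le_antisymm ha.1.2 (ha.2 ⟨hτC, le_refl τ⟩)
    have := (hHτ τ hτ).2.1
    simp only [hW]
    rwa [e] at this ⊢
  obtain ⟨g, g1, g2, g3, g4⟩ := exists_lipschitz_reparam (w := W) zero_le_one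
    ((continuousOn_arcLength hK hwle).mono Icc_subset_Ici_self) hWd
  have hΛ : S 1 = (weightedLength w u).toReal := rfl
  have hS0 : S 0 = 0 := arcLength_zero
  -- Rescaling the clock to `[0,1]` makes the total weighted length the Lipschitz constant.
  refine ⟨fun τ => g (S 1 * τ), ?_, ?_, ?_, ?_⟩
  · refine LipschitzWith.of_dist_le_mul fun s t => ?_
    refine (g1.dist_le_mul _ _).trans (le_of_eq ?_)
    rw [NNReal.coe_one, one_mul, Real.dist_eq, Real.dist_eq, ← mul_sub, abs_mul, hΛ,
      abs_of_nonneg ENNReal.toReal_nonneg]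
    rfl
  · simp only [mul_zero]
    rw [g2 0 hS0.ge, hWC 0 (by simp) h0C, u.fn_zero]
  · simp only [mul_one]
    rw [g3 _ le_rfl, hWC 1 (by simp) h1C, u.fn_one]
  · intro τ
    obtain ⟨σ, hσ, he⟩ := g4 (S 1 * τ)
    simp only [← he]
    exact (hHτ σ hσ).2.2.2 _

theorem weightedLength_ne_top {x y : Euc d} {w : Euc d → ℝ≥0∞} {t : ℝ≥0} (hw : ∀ v, w v ≤ t)
    (u : CurveSpace x y) : weightedLength w u ≠ ⊤ := by
  obtain ⟨K, hK⟩ := u.exists_lipschitzWith_fn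
  exact arcCost_ne_top hK hw _ _

/-- Between white points, the black coefficient does not matter once it is at least `β`. -/
theorem weightDist_blackWeight_eq {Ω : Set (Euc d)} (ho : IsOpen Ω) (hc : Ω ⊆ unitCube d) {β : ℝ}
    (hβ : 1 < β) (hΩ : BoundaryCheaper Ω β) {x y : Euc d} (hx : x ∈ whiteSet Ω)
    (hy : y ∈ whiteSet Ω) {t : ℝ≥0∞} (ht : ENNReal.ofReal β ≤ t) :
    weightDist (blackWeight Ω t) x y = weightDist (blackWeight Ω (ENNReal.ofReal β)) x y := by
  refine le_antisymm (le_iInf fun u => ?_) (weightDist_mono (blackWeight_mono ht) x y)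
  obtain ⟨g, g1, g2, g3, g4⟩ := exists_white_curve ho hc hβ hΩ hx hy u
  have h1 := weightDist_le_arcCost (w := blackWeight Ω t) g1 zero_le_one
  rw [g2, g3] at h1
  have hne : weightedLength (blackWeight Ω (ENNReal.ofReal β)) u ≠ ⊤ :=
    weightedLength_ne_top (t := Real.toNNReal β)
      (fun v => blackWeight_le (by simpa using hβ.le) v) u
  refine h1.trans ((arcCost_le_of_lipschitz g1
    fun τ _ => (blackWeight_of_mem_whiteSet (g4 τ)).le).trans ?_)
  simp [ENNReal.coe_toNNReal hne]

/-! ### The coefficient exceeds one; the last entrance into a cell -/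

theorem enorm_sub_le_constrainedDist (E : Set (Euc d)) (x y : Euc d) :
    ‖y - x‖ₑ ≤ constrainedDist E 1 x y := by
  refine le_iInf₂ fun u _ => ?_
  obtain ⟨K, hK⟩ := u.exists_lipschitzWith_fn
  have := arcCost_const_mul_le (w := fun _ => ENNReal.ofReal 1) (t := 1) hK zero_le_one (by simp)
  rwa [u.fn_zero, u.fn_one, one_mul] at this

theorem norm_le_of_mem_unitCube {x : Euc d} (hx : x ∈ unitCube d) : ‖x‖ ≤ √d := by
  rw [EuclideanSpace.norm_eq]
  refine Real.sqrt_le_sqrt ?_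
  calc ∑ i, ‖x i‖ ^ 2 ≤ ∑ _i : Fin d, (1 : ℝ) := by
        refine Finset.sum_le_sum fun i _ => ?_
        rw [Real.norm_eq_abs, sq_abs]
        nlinarith [(hx i).1, (hx i).2]
    _ = d := by simp

/-- A coefficient for which boundary paths are cheaper exceeds `1`: compare the two distances
between the end points of a chord. -/
theorem one_lt_of_boundaryCheaper {Ω : Set (Euc d)} (ho : IsOpen Ω) (hc : Ω ⊆ unitCube d)
    (hne : Ω.Nonempty) (hfr : (frontier Ω).Nonempty) {β : ℝ} (hΩ : BoundaryCheaper Ω β) :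
    1 < β := by
  obtain ⟨c, hcΩ⟩ := hne
  obtain ⟨x₀, hx₀⟩ := hfr
  have hx₀' : x₀ ∉ Ω := fun h => by
    rw [ho.frontier_eq] at hx₀; exact hx₀.2 h
  set e : Euc d := x₀ - c with he
  have hene : e ≠ 0 := fun h => hx₀' (by rw [sub_eq_zero.1 h]; exact hcΩ)
  have hepos : 0 < ‖e‖ := norm_pos_iff.2 hene
  set f : ℝ → Euc d := fun s => c + s • e with hf
  have hfL : LipschitzWith ‖e‖₊ f := by
    refine LipschitzWith.of_dist_le_mul fun s t => ?_
    rw [dist_add_left, dist_eq_norm, ← sub_smul, norm_smul, mul_comm]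
    rfl
  have hCc : IsClosed {s | f s ∉ Ω} := (ho.preimage hfL.continuous).isClosed_compl
  have h1 : (1 : ℝ) ∈ {s | f s ∉ Ω} := by simpa [hf, he] using hx₀'
  have h0 : (0 : ℝ) ∉ {s | f s ∉ Ω} := by simpa [hf] using hcΩ
  -- Far enough backwards along the line the norm exceeds `√d`, which puts the point outside the
  -- cube.
  obtain ⟨N, hN, hN0⟩ : ∃ N : ℝ, -N ∈ {s | f s ∉ Ω} ∧ 0 ≤ N := by
    refine ⟨(√d + ‖c‖ + 1) / ‖e‖, fun h => ?_, by positivity⟩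
    have h2 := norm_le_of_mem_unitCube (hc h)
    have h3 : ‖(-((√d + ‖c‖ + 1) / ‖e‖)) • e‖ = √d + ‖c‖ + 1 := by
      rw [norm_smul, norm_neg, norm_div, norm_norm, div_mul_cancel₀ _ hepos.ne',
        Real.norm_of_nonneg (by positivity)]
    have h4 := norm_sub_norm_le ((-((√d + ‖c‖ + 1) / ‖e‖)) • e) (-c)
    rw [h3, norm_neg, sub_neg_eq_add, add_comm _ c] at h4
    simp only [hf] at h2
    linarith
  obtain ⟨a, ha⟩ := hCc.exists_isGreatest_inter_Iic hN (τ := 0) (by linarith)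
  obtain ⟨b, hb⟩ := hCc.exists_isLeast_inter_Ici h1 zero_le_one
  have ha0 : a < 0 := lt_of_le_of_ne ha.1.2 fun h => h0 (h ▸ ha.1.1)
  have hb0 : 0 < b := lt_of_le_of_ne hb.1.2 fun h => h0 (h ▸ hb.1.1)
  have hab : a < b := ha0.trans hb0
  have hin : ∀ τ ∈ Ioo a b, f τ ∈ Ω := by
    intro σ hσ
    by_contra hσC
    rcases le_total σ 0 with h | h
    · exact absurd (ha.2 ⟨hσC, h⟩) (not_le.2 hσ.1)
    · exact absurd (hb.2 ⟨hσC, h⟩) (not_le.2 hσ.2)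
  have hfa := mem_frontier_of_left ho hfL.continuous hab hin ha.1.1
  have hfb := mem_frontier_of_right ho hfL.continuous hab hin hb.1.1
  have hsub : f b - f a = (b - a) • e := by simp only [hf]; rw [sub_smul]; abel
  have hnorm : ‖f b - f a‖ₑ = ENNReal.ofReal (‖e‖ * (b - a)) := by
    rw [hsub, enorm_smul, Real.enorm_eq_ofReal (by linarith), ← ofReal_norm, mul_comm,
      ENNReal.ofReal_mul hepos.le]
  have hfab : f a ≠ f b := fun h => by
    rw [h, sub_self] at hsub
    rcases smul_eq_zero.1 hsub.symm with h | h
    · linarith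
    · exact hene h
  -- Chord length is at most the boundary distance, which is less than `β` times chord length.
  have hlt := (enorm_sub_le_constrainedDist (frontier Ω) _ _).trans_lt
    ((hΩ _ hfa _ hfb hfab).trans_le ((constrainedDist_le_arcCost hfL hab hin).trans
      (arcCost_le_of_lipschitz hfL fun _ _ => le_rfl)))
  rw [hnorm, mul_assoc, ← enorm_eq_nnnorm, ← ofReal_norm, ← ENNReal.ofReal_mul hepos.le] at hlt
  by_contra hcon
  refine absurd hlt (not_lt.2 ?_)
  calc _ ≤ 1 * ENNReal.ofReal (‖e‖ * (b - a)) := by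
        gcongr
        simpa using not_lt.1 hcon
    _ = _ := one_mul _

/-- Cost of reaching a black point: split the curve at its last entrance into the cell. -/
theorem exists_last_entrance {Ω : Set (Euc d)} (ho : IsOpen Ω)
    {x y : Euc d} (hx : x ∈ whiteSet Ω) {z : Fin d → ℤ} (hy : y - latticeVec z ∈ Ω) (t : ℝ≥0∞)
    (u : CurveSpace x y) : ∃ q : Euc d, q - latticeVec z ∈ frontier Ω ∧
      weightDist (blackWeight Ω t) x q + t * ‖y - q‖ₑ ≤
        weightedLength (blackWeight Ω t) u := by
  obtain ⟨K, hK⟩ := u.exists_lipschitzWith_fn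
  have hg : LipschitzWith (K + 0) (fun τ => u.fn τ - latticeVec z) :=
    hK.sub (LipschitzWith.const _)
  have hCc : IsClosed {s | u.fn s - latticeVec z ∉ Ω} :=
    (ho.preimage hg.continuous).isClosed_compl
  have h0 : (0 : ℝ) ∈ {s | u.fn s - latticeVec z ∉ Ω} := by
    simp only [mem_ofPred_eq, u.fn_zero]
    exact fun h => hx ⟨z, h⟩
  -- The last parameter outside the cell `z`; afterwards the weight is constantly `t`.
  obtain ⟨a, ha⟩ := hCc.exists_isGreatest_inter_Iic h0 zero_le_one
  have ha0 : 0 ≤ a := ha.2 ⟨h0, zero_le_one' ℝ⟩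
  have ha1 : a < 1 := lt_of_le_of_ne ha.1.2 fun h => ha.1.1 (by rw [h, u.fn_one]; exact hy)
  have hin : ∀ τ ∈ Ioo a 1, u.fn τ - latticeVec z ∈ Ω := by
    intro σ hσ
    by_contra hσC
    exact absurd (ha.2 ⟨hσC, hσ.2.le⟩) (not_le.2 hσ.1)
  refine ⟨u.fn a, mem_frontier_of_left ho hg.continuous ha1 hin ha.1.1, ?_⟩
  rw [weightedLength_eq_arcCost, ← arcCost_add ha0 ha1.le]
  refine add_le_add ?_ ?_
  · have := weightDist_le_arcCost (w := blackWeight Ω t) hK ha0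
    rwa [u.fn_zero] at this
  · have := arcCost_const_mul_le (w := blackWeight Ω t) (t := t) hK ha1.le
      fun τ hτ => (blackWeight_of_mem ⟨z, hin τ hτ⟩).ge
    rwa [u.fn_one] at this

/-! ### Rescaling to period one and growth along the diagonal -/

/-- The value `β ε^{-p}` (or `∞`) of the metric coefficient on the black set. -/
noncomputable def blackCoeff (β : ℝ) (p : ℝ≥0∞) (ε : ℝ) : ℝ≥0∞ :=
  if p = ⊤ then ⊤ else ENNReal.ofReal (β * ε ^ (-p.toReal))

theorem metricCoeff_eq (Ω : Set (Euc d)) (β : ℝ) (p : ℝ≥0∞) (ε : ℝ) :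
    metricCoeff Ω β p ε = blackWeight Ω (blackCoeff β p ε) := by
  funext x
  simp only [metricCoeff, blackWeight, blackCoeff]

theorem ofReal_le_blackCoeff {β : ℝ} (hβ : 0 ≤ β) (p : ℝ≥0∞) {ε : ℝ} (h0 : 0 < ε) (h1 : ε ≤ 1) :
    ENNReal.ofReal β ≤ blackCoeff β p ε := by
  unfold blackCoeff
  split_ifs with h
  · exact le_top
  · refine ENNReal.ofReal_le_ofReal (le_mul_of_one_le_right hβ ?_)
    exact Real.one_le_rpow_of_pos_of_le_one_of_nonpos h0 h1 (by simp)

theorem inducedDist_eq (Ω : Set (Euc d)) (β : ℝ) (p : ℝ≥0∞) {ε : ℝ} (h0 : 0 < ε) (y : Euc d) :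
    inducedDist Ω β p ε 0 y =
      ENNReal.ofReal ε * weightDist (blackWeight Ω (blackCoeff β p ε)) 0 (ε⁻¹ • y) := by
  have := weightDist_smul (fun v => metricCoeff Ω β p ε (ε⁻¹ • v)) 0 (ε⁻¹ • y) h0
  simp only [smul_smul, mul_inv_cancel₀ h0.ne', inv_mul_cancel₀ h0.ne', one_smul, smul_zero] at this
  rw [← metricCoeff_eq]
  exact this

/-- The lattice vector `(n, …, n)`. -/
noncomputable def diagVec (d n : ℕ) : Euc d := latticeVec fun _ => (n : ℤ)

theorem diagVec_add (m n : ℕ) : diagVec d (m + n) = diagVec d m + diagVec d n := by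
  ext i; simp [diagVec, latticeVec]

/-- Together with `smul_cubeCentre_odd`, this is the source of the dichotomy: a white lattice point
here, a black cell centre there. -/
theorem smul_cubeCentre_even (k : ℕ) :
    (1 / (2 * ((k : ℝ) + 1)))⁻¹ • cubeCentre d = diagVec d (k + 1) := by
  ext i; simp [diagVec, latticeVec, cubeCentre]; ring

theorem smul_cubeCentre_odd (k : ℕ) :
    (1 / (2 * ((k : ℝ) + 1) + 1))⁻¹ • cubeCentre d = cubeCentre d + diagVec d (k + 1) := by
  ext i; simp [diagVec, latticeVec, cubeCentre]; ring

/-- The distance from the origin to `(n, …, n)` with black coefficient `β`. -/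
noncomputable def diagDist (Ω : Set (Euc d)) (β : ℝ) (n : ℕ) : ℝ :=
  (weightDist (blackWeight Ω (ENNReal.ofReal β)) 0 (diagVec d n)).toReal

theorem weightDist_blackWeight_le {Ω : Set (Euc d)} {β : ℝ} (hβ : 1 ≤ β) (x y : Euc d) :
    weightDist (blackWeight Ω (ENNReal.ofReal β)) x y ≤ ENNReal.ofReal (β * ‖y - x‖) := by
  refine (weightDist_le_of_segment fun v => blackWeight_le (by simpa using hβ) v).trans ?_
  rw [← ofReal_norm, ← ENNReal.ofReal_mul (by linarith)]

theorem ofReal_diagDist {Ω : Set (Euc d)} {β : ℝ} (hβ : 1 ≤ β) (n : ℕ) :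
    ENNReal.ofReal (diagDist Ω β n) =
      weightDist (blackWeight Ω (ENNReal.ofReal β)) 0 (diagVec d n) :=
  ENNReal.ofReal_toReal
    (ne_top_of_le_ne_top ENNReal.ofReal_ne_top (weightDist_blackWeight_le hβ _ _))

theorem diagDist_nonneg (Ω : Set (Euc d)) (β : ℝ) (n : ℕ) : 0 ≤ diagDist Ω β n :=
  ENNReal.toReal_nonneg

/-- Concatenate at `(m,…,m)` and translate the second piece back by a period. Fekete's lemma then
gives the limit of the averages. -/
theorem subadditive_diagDist (Ω : Set (Euc d)) {β : ℝ} (hβ : 1 ≤ β) :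
    Subadditive (diagDist Ω β) := by
  intro m n
  rw [← ENNReal.ofReal_le_ofReal_iff (add_nonneg (diagDist_nonneg _ _ _) (diagDist_nonneg _ _ _)),
    ENNReal.ofReal_add (diagDist_nonneg _ _ _) (diagDist_nonneg _ _ _), ofReal_diagDist hβ,
    ofReal_diagDist hβ, ofReal_diagDist hβ]
  refine (weightDist_triangle _ _ (diagVec d m) _).trans (add_le_add le_rfl ?_)
  have := weightDist_add_right_le (z := diagVec d m)
    (fun v => blackWeight_add_latticeVec Ω (ENNReal.ofReal β) v _) 0 (diagVec d n)
  rwa [zero_add, add_comm, ← diagVec_add] at this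

theorem exists_tendsto_diagDist (Ω : Set (Euc d)) {β : ℝ} (hβ : 1 ≤ β) :
    ∃ m : ℝ, 0 ≤ m ∧ Tendsto (fun k : ℕ => diagDist Ω β (k + 1) / ((k : ℝ) + 1)) atTop (𝓝 m) := by
  have h := (subadditive_diagDist Ω hβ).tendsto_lim
    ⟨0, by rintro _ ⟨n, rfl⟩; exact div_nonneg (diagDist_nonneg _ _ _) n.cast_nonneg⟩
  have h2 := h.comp (tendsto_add_atTop_nat 1)
  refine ⟨_, ge_of_tendsto' h fun n => div_nonneg (diagDist_nonneg _ _ _) n.cast_nonneg, ?_⟩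
  refine h2.congr fun k => ?_
  simp

/-! ### Cost of the black target and limits of the distances -/

section

variable {Ω : Set (Euc d)} {β : ℝ} {t : ℝ≥0∞}

theorem diagVec_mem_whiteSet (h0 : (0 : Euc d) ∈ whiteSet Ω) (n : ℕ) :
    diagVec d n ∈ whiteSet Ω := by
  have := (add_latticeVec_mem_whiteSet (Ω := Ω) (x := 0) fun _ => (n : ℤ)).2 h0
  rwa [zero_add] at this

theorem norm_le_of_mem_frontier (hc : Ω ⊆ unitCube d) {x : Euc d} (hx : x ∈ frontier Ω) :
    ‖x‖ ≤ √d := by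
  have : closure Ω ⊆ Metric.closedBall 0 √d := closure_minimal
    (fun y hy => by simpa using norm_le_of_mem_unitCube (hc hy)) Metric.isClosed_closedBall
  simpa using this (frontier_subset_closure hx)

/-- A boundary point nearest to a given point. -/
theorem exists_nearest_frontier (hc : Ω ⊆ unitCube d) (hfr : (frontier Ω).Nonempty) (c : Euc d) :
    ∃ q ∈ frontier Ω, ∀ q' ∈ frontier Ω, ‖c - q‖ ≤ ‖c - q'‖ := by
  have hsub : frontier Ω ⊆ Metric.closedBall 0 √d := fun x hx => by
    rw [mem_closedBall_zero_iff]
    exact norm_le_of_mem_frontier hc hx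
  have hcomp : IsCompact (frontier Ω) :=
    (isCompact_closedBall _ _).of_isClosed_subset isClosed_frontier hsub
  have hcont : ContinuousOn (fun q => ‖c - q‖) (frontier Ω) := by fun_prop
  exact hcomp.exists_isMinOn hfr hcont

/-- Up to the last entrance point `q` the cost is at least the distance for the coefficient `β`; `q`
is within `√d` of the lattice corner of its cell, and the final black piece costs at least `t ρ`. -/
theorem weightDist_centre_ge (ho : IsOpen Ω) (hc : Ω ⊆ unitCube d) (hβ : 1 < β)
    (h0 : (0 : Euc d) ∈ whiteSet Ω) (ht : ENNReal.ofReal β ≤ t)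
    {c : Euc d} (hcΩ : c ∈ Ω) {ρ : ℝ} (hρ : ∀ q ∈ frontier Ω, ρ ≤ ‖c - q‖) (n : ℕ) :
    ENNReal.ofReal (diagDist Ω β n) + t * ENNReal.ofReal ρ ≤
      weightDist (blackWeight Ω t) 0 (c + diagVec d n) + ENNReal.ofReal (β * √d) := by
  rw [weightDist, ENNReal.iInf_add]
  refine le_iInf fun u => ?_
  obtain ⟨q, hq, hle⟩ := exists_last_entrance ho h0 (z := fun _ => (n : ℤ))
    (by rw [diagVec, add_sub_cancel_right]; exact hcΩ) t u
  have e1 : t * ENNReal.ofReal ρ ≤ t * ‖c + diagVec d n - q‖ₑ := by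
    rw [← ofReal_norm]
    gcongr
    refine (hρ _ hq).trans (le_of_eq ?_)
    congr 1; rw [diagVec]; abel
  have e2 : ENNReal.ofReal (diagDist Ω β n) ≤
      weightDist (blackWeight Ω t) 0 q + ENNReal.ofReal (β * √d) := by
    rw [ofReal_diagDist hβ.le]
    refine (weightDist_triangle _ _ q _).trans (add_le_add
      (weightDist_mono (blackWeight_mono ht) _ _) ?_)
    refine (weightDist_blackWeight_le hβ.le _ _).trans (ENNReal.ofReal_le_ofReal ?_)
    rw [norm_sub_rev]
    have := norm_le_of_mem_frontier hc hq
    rw [diagVec]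
    gcongr
  calc _ ≤ weightDist (blackWeight Ω t) 0 q + ENNReal.ofReal (β * √d) +
        t * ‖c + diagVec d n - q‖ₑ := add_le_add e2 e1
    _ = weightDist (blackWeight Ω t) 0 q + t * ‖c + diagVec d n - q‖ₑ +
        ENNReal.ofReal (β * √d) := by ring
    _ ≤ _ := by gcongr

/-- Travel through the lattice corner and a boundary point to the target. The first two legs join
white points, so `t` may be replaced by `β`; only the last segment pays `t`. -/
theorem weightDist_centre_le (ho : IsOpen Ω) (hc : Ω ⊆ unitCube d) (hβ : 1 < β)
    (hΩ : BoundaryCheaper Ω β) (h0 : (0 : Euc d) ∈ whiteSet Ω) (ht : ENNReal.ofReal β ≤ t)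
    {c q : Euc d} (hq : q ∈ frontier Ω) (n : ℕ) :
    weightDist (blackWeight Ω t) 0 (c + diagVec d n) ≤
      ENNReal.ofReal (diagDist Ω β n) + ENNReal.ofReal (β * √d) +
        t * ENNReal.ofReal ‖c - q‖ := by
  have hn := diagVec_mem_whiteSet h0 n
  have hqn : q + diagVec d n ∈ whiteSet Ω :=
    mem_whiteSet_of_mem_frontier ho hc (z := fun _ => (n : ℤ))
      (by rw [diagVec, add_sub_cancel_right]; exact hq)
  have ht1 : 1 ≤ t := le_trans (by simpa using hβ.le) ht
  refine (weightDist_triangle _ _ (q + diagVec d n) _).trans (add_le_add ?_ ?_)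
  · refine (weightDist_triangle _ _ (diagVec d n) _).trans (add_le_add ?_ ?_)
    · rw [weightDist_blackWeight_eq ho hc hβ hΩ h0 hn ht, ofReal_diagDist hβ.le]
    · rw [weightDist_blackWeight_eq ho hc hβ hΩ hn hqn ht]
      refine (weightDist_blackWeight_le hβ.le _ _).trans (ENNReal.ofReal_le_ofReal ?_)
      have := norm_le_of_mem_frontier hc hq
      rw [add_sub_cancel_right]
      gcongr
  · refine (weightDist_le_of_segment (blackWeight_le ht1)).trans (le_of_eq ?_)
    rw [add_sub_add_right_eq_sub, ofReal_norm]

theorem inducedDist_even (ho : IsOpen Ω) (hc : Ω ⊆ unitCube d) (hβ : 1 < β)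
    (hΩ : BoundaryCheaper Ω β) (h0 : (0 : Euc d) ∈ whiteSet Ω) (p : ℝ≥0∞) (k : ℕ) :
    inducedDist Ω β p (1 / (2 * ((k : ℝ) + 1))) 0 (cubeCentre d) =
      ENNReal.ofReal (diagDist Ω β (k + 1) / ((k : ℝ) + 1) / 2) := by
  have hε : (0 : ℝ) < 1 / (2 * ((k : ℝ) + 1)) := by positivity
  have hε1 : 1 / (2 * ((k : ℝ) + 1)) ≤ 1 := by
    rw [div_le_one (by positivity)]; linarith [k.cast_nonneg (α := ℝ)]
  rw [inducedDist_eq Ω β p hε, smul_cubeCentre_even,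
    weightDist_blackWeight_eq ho hc hβ hΩ h0 (diagVec_mem_whiteSet h0 _)
      (ofReal_le_blackCoeff (by linarith) p hε hε1), ← ofReal_diagDist hβ.le,
    ← ENNReal.ofReal_mul hε.le]
  congr 1
  field_simp

theorem tendsto_inducedDist_even (ho : IsOpen Ω) (hc : Ω ⊆ unitCube d) (hβ : 1 < β)
    (hΩ : BoundaryCheaper Ω β) (h0 : (0 : Euc d) ∈ whiteSet Ω) (p : ℝ≥0∞) {m : ℝ}
    (hm : Tendsto (fun k : ℕ => diagDist Ω β (k + 1) / ((k : ℝ) + 1)) atTop (𝓝 m)) :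
    Tendsto (fun k : ℕ => inducedDist Ω β p (1 / (2 * ((k : ℝ) + 1))) 0 (cubeCentre d))
      atTop (𝓝 (ENNReal.ofReal (m / 2))) := by
  simp only [inducedDist_even ho hc hβ hΩ h0]
  exact ENNReal.tendsto_ofReal (hm.div_const 2)

theorem tendsto_odd_eps :
    Tendsto (fun k : ℕ => 1 / (2 * ((k : ℝ) + 1) + 1)) atTop (𝓝 0) := by
  refine squeeze_zero (fun k => by positivity) (fun k => ?_) tendsto_one_div_add_atTop_nhds_zero_nat
  gcongr
  linarith [k.cast_nonneg (α := ℝ)]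

theorem tendsto_inducedDist_odd_one (ho : IsOpen Ω) (hc : Ω ⊆ unitCube d) (hβ : 1 < β)
    (hΩ : BoundaryCheaper Ω β) (h0 : (0 : Euc d) ∈ whiteSet Ω) (hcΩ : cubeCentre d ∈ Ω)
    {q : Euc d} (hq : q ∈ frontier Ω)
    (hmin : ∀ q' ∈ frontier Ω, ‖cubeCentre d - q‖ ≤ ‖cubeCentre d - q'‖) {m : ℝ}
    (hm : Tendsto (fun k : ℕ => diagDist Ω β (k + 1) / ((k : ℝ) + 1)) atTop (𝓝 m)) :
    Tendsto (fun k : ℕ => inducedDist Ω β 1 (1 / (2 * ((k : ℝ) + 1) + 1)) 0 (cubeCentre d))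
      atTop (𝓝 (ENNReal.ofReal (m / 2 + β * ‖cubeCentre d - q‖))) := by
  set ρ := ‖cubeCentre d - q‖ with hρ
  set ε : ℕ → ℝ := fun k => 1 / (2 * ((k : ℝ) + 1) + 1) with hεdef
  have hε0 : ∀ k, 0 < ε k := fun k => by simp only [hεdef]; positivity
  have hε1 : ∀ k, ε k ≤ 1 := fun k => by
    simp only [hεdef]
    rw [div_le_one (by positivity)]; linarith [k.cast_nonneg (α := ℝ)]
  have hεt : Tendsto ε atTop (𝓝 0) := tendsto_odd_eps
  have hcoeff : ∀ k, blackCoeff β 1 (ε k) = ENNReal.ofReal (β * (ε k)⁻¹) := fun k => by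
    simp [blackCoeff, Real.rpow_neg_one]
  have hmain : Tendsto (fun k => ε k * diagDist Ω β (k + 1)) atTop (𝓝 (m / 2)) := by
    have h1 : Tendsto (fun k => (1 - ε k) / 2) atTop (𝓝 ((1 - 0) / 2)) :=
      (tendsto_const_nhds.sub hεt).div_const 2
    have h2 := hm.mul h1
    rw [show m * ((1 - 0) / 2) = m / 2 by ring] at h2
    refine h2.congr fun k => ?_
    simp only [hεdef]
    field_simp
    ring
  have hlow : Tendsto (fun k => ENNReal.ofReal
      (ε k * diagDist Ω β (k + 1) + β * ρ - ε k * (β * √d))) atTop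
      (𝓝 (ENNReal.ofReal (m / 2 + β * ρ))) := by
    refine ENNReal.tendsto_ofReal ?_
    simpa using (hmain.add_const (β * ρ)).sub (hεt.mul_const (β * √d))
  have hupp : Tendsto (fun k => ENNReal.ofReal
      (ε k * diagDist Ω β (k + 1) + ε k * (β * √d) + β * ρ)) atTop
      (𝓝 (ENNReal.ofReal (m / 2 + β * ρ))) := by
    refine ENNReal.tendsto_ofReal ?_
    simpa using (hmain.add (hεt.mul_const (β * √d))).add_const (β * ρ)
  have hβ0 : 0 ≤ β := by linarith
  -- For `p = 1` the scaling factor `ε` exactly cancels the black coefficient `β/ε`, leaving a fixed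
  -- positive jump.
  have hprod : ∀ k, ENNReal.ofReal (ε k) * (ENNReal.ofReal (β * (ε k)⁻¹) * ENNReal.ofReal ρ) =
      ENNReal.ofReal (β * ρ) := fun k => by
    have := hε0 k
    rw [← ENNReal.ofReal_mul (by positivity), ← ENNReal.ofReal_mul (hε0 k).le]
    congr 1
    field_simp
  refine tendsto_of_tendsto_of_tendsto_of_le_of_le hlow hupp (fun k => ?_) fun k => ?_
  · have h := weightDist_centre_ge ho hc hβ h0 (ofReal_le_blackCoeff hβ0 1 (hε0 k) (hε1 k)) hcΩ
      hmin (k + 1)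
    have hs := diagDist_nonneg Ω β (k + 1)
    have h' := mul_le_mul_right h (ENNReal.ofReal (ε k))
    rw [hcoeff, mul_add, mul_add, hprod, ← ENNReal.ofReal_mul (hε0 k).le,
      ← ENNReal.ofReal_mul (hε0 k).le, ← ENNReal.ofReal_add (mul_nonneg (hε0 k).le hs)
      (by positivity), ← tsub_le_iff_right,
      ← ENNReal.ofReal_sub _ (mul_nonneg (hε0 k).le (by positivity))] at h'
    refine h'.trans (le_of_eq ?_)
    rw [inducedDist_eq Ω β 1 (hε0 k), hcoeff]
    simp only [hεdef, smul_cubeCentre_odd]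
  · have h := weightDist_centre_le ho hc hβ hΩ h0
      (ofReal_le_blackCoeff hβ0 1 (hε0 k) (hε1 k)) (c := cubeCentre d) hq (k + 1)
    have hs := diagDist_nonneg Ω β (k + 1)
    have h' := mul_le_mul_right h (ENNReal.ofReal (ε k))
    rw [hcoeff, mul_add, mul_add, hprod, ← ENNReal.ofReal_mul (hε0 k).le,
      ← ENNReal.ofReal_mul (hε0 k).le, ← ENNReal.ofReal_add (mul_nonneg (hε0 k).le hs)
      (mul_nonneg (hε0 k).le (by positivity)), ← ENNReal.ofReal_add
      (add_nonneg (mul_nonneg (hε0 k).le hs) (mul_nonneg (hε0 k).le (by positivity)))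
      (by positivity)] at h'
    refine le_trans (le_of_eq ?_) h'
    rw [inducedDist_eq Ω β 1 (hε0 k), hcoeff]
    simp only [hεdef, smul_cubeCentre_odd]

theorem tendsto_inducedDist_odd_top (ho : IsOpen Ω) (hc : Ω ⊆ unitCube d) (hβ : 1 < β)
    (h0 : (0 : Euc d) ∈ whiteSet Ω) (hcΩ : cubeCentre d ∈ Ω)
    {ρ : ℝ} (hρ0 : 0 < ρ) (hρ : ∀ q ∈ frontier Ω, ρ ≤ ‖cubeCentre d - q‖)
    {p : ℝ≥0∞} (hp : 1 < p) :
    Tendsto (fun k : ℕ => inducedDist Ω β p (1 / (2 * ((k : ℝ) + 1) + 1)) 0 (cubeCentre d))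
      atTop (𝓝 ⊤) := by
  have hβ0 : 0 < β := by linarith
  set N : ℕ → ℝ := fun k => 2 * ((k : ℝ) + 1) + 1 with hN
  have hN1 : ∀ k, 1 ≤ N k := fun k => by
    simp only [hN]; linarith [k.cast_nonneg (α := ℝ)]
  have hε0 : ∀ k, 0 < 1 / N k := fun k => by have := hN1 k; positivity
  have hε1 : ∀ k, 1 / N k ≤ 1 := fun k => by
    rw [div_le_one (by linarith [hN1 k])]; exact hN1 k
  have key : ∀ k, ENNReal.ofReal (1 / N k) * (blackCoeff β p (1 / N k) * ENNReal.ofReal ρ) ≤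
      inducedDist Ω β p (1 / N k) 0 (cubeCentre d) + ENNReal.ofReal (β * √d) := fun k => by
    have h := weightDist_centre_ge ho hc hβ h0 (ofReal_le_blackCoeff hβ0.le p (hε0 k) (hε1 k))
      hcΩ hρ (k + 1)
    -- The diagonal term is discarded: the black entry cost alone diverges.
    have h' := mul_le_mul_right (le_add_self.trans h) (ENNReal.ofReal (1 / N k))
    rw [mul_add, ← smul_cubeCentre_odd, ← inducedDist_eq Ω β p (hε0 k)] at h'
    refine h'.trans (add_le_add le_rfl ?_)
    exact mul_le_of_le_one_left' (by simpa using hε1 k)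
  by_cases hpt : p = ⊤
  · subst hpt
    refine tendsto_const_nhds.congr fun k => ?_
    have h := key k
    have hε := hε0 k
    rw [blackCoeff, if_pos rfl, ENNReal.top_mul (by simpa using hρ0),
      ENNReal.mul_top (by simpa using hε), top_le_iff, ENNReal.add_eq_top] at h
    exact (h.resolve_right ENNReal.ofReal_ne_top).symm
  · have hp1 : 1 < p.toReal := by
      have := (ENNReal.toReal_lt_toReal ENNReal.one_ne_top hpt).2 hp
      simpa using this
    have hNt : Tendsto N atTop atTop := by
      refine tendsto_atTop_mono (fun k => ?_) tendsto_natCast_atTop_atTop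
      simp only [hN]; linarith [k.cast_nonneg (α := ℝ)]
    have hlow : Tendsto (fun k => ENNReal.ofReal
        (β * ρ * N k ^ (p.toReal - 1) + -(β * √d))) atTop (𝓝 ⊤) := by
      refine ENNReal.tendsto_ofReal_atTop.comp ?_
      refine tendsto_atTop_add_const_right _ _ (Tendsto.const_mul_atTop (by positivity) ?_)
      exact (tendsto_rpow_atTop (by linarith)).comp hNt
    refine tendsto_of_tendsto_of_tendsto_of_le_of_le hlow tendsto_const_nhds (fun k => ?_)
      fun k => le_top
    have h := key k
    have hNk := hN1 k
    have e : 1 / N k * (β * (1 / N k) ^ (-p.toReal) * ρ) = β * ρ * N k ^ (p.toReal - 1) := by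
      rw [one_div, Real.inv_rpow (by linarith), Real.rpow_neg (by linarith), inv_inv,
        Real.rpow_sub_one (by linarith)]
      field_simp
    rw [blackCoeff, if_neg hpt, ← ENNReal.ofReal_mul (by positivity),
      ← ENNReal.ofReal_mul (hε0 k).le, e, ← tsub_le_iff_right,
      ← ENNReal.ofReal_sub _ (by positivity)] at h
    simpa only [sub_eq_add_neg] using h

end

/-! ### Compactness of curves and near minimizers -/

theorem isCompact_lipschitz_curves (C : ℝ≥0) (x y : Euc d) :
    IsCompact {u : C(unitInterval, Euc d) | LipschitzWith C u ∧ u 0 = x ∧ u 1 = y} := by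
  refine ArzelaAscoli.isCompact_of_equicontinuous _ ?_ ?_
  · have himg : ContinuousMap.toFun ''
        {u : C(unitInterval, Euc d) | LipschitzWith C u ∧ u 0 = x ∧ u 1 = y} =
        {f : unitInterval → Euc d | LipschitzWith C f} ∩ {f | f 0 = x} ∩ {f | f 1 = y} := by
      ext f
      constructor
      · rintro ⟨u, ⟨h1, h2, h3⟩, rfl⟩
        exact ⟨⟨h1, h2⟩, h3⟩
      · rintro ⟨⟨h1, h2⟩, h3⟩
        exact ⟨⟨f, h1.continuous⟩, ⟨h1, h2, h3⟩, rfl⟩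
    rw [himg]
    -- A `C`-Lipschitz curve on the unit interval starting at `x` stays in the ball of radius `C`
    -- about `x`.
    refine (isCompact_univ_pi fun _ => isCompact_closedBall x C).of_isClosed_subset
      (((isClosed_setOfPred_lipschitzWith C).inter
        (isClosed_eq (continuous_apply 0) continuous_const)).inter
        (isClosed_eq (continuous_apply 1) continuous_const)) ?_
    rintro f ⟨⟨h1, h2⟩, -⟩ t -
    have h2 : f 0 = x := h2
    have := h1.dist_le_mul t 0
    rw [h2] at this
    refine this.trans (mul_le_of_le_one_right C.2 ?_)
    rw [Subtype.dist_eq, Real.dist_eq, Icc.coe_zero, sub_zero, abs_of_nonneg t.2.1]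
    exact t.2.2
  · exact (LipschitzWith.uniformEquicontinuous _ C fun u => u.2.1).equicontinuous

/-- Uniformly Lipschitz curves subconverge uniformly. -/
theorem CurveSpace.exists_tendsto_subseq {x y : Euc d} {C : ℝ≥0} (v : ℕ → CurveSpace x y)
    (hv : ∀ k, LipschitzWith C (v k).1) :
    ∃ (u : CurveSpace x y) (φ : ℕ → ℕ), StrictMono φ ∧ Tendsto (v ∘ φ) atTop (𝓝 u) := by
  obtain ⟨u, hu, φ, hφ, hlim⟩ := (isCompact_lipschitz_curves C x y).tendsto_subseq
    (x := fun k => (v k).1) fun k => ⟨hv k, (v k).2.2⟩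
  let u' : CurveSpace x y := ⟨u, ⟨C, hu.1⟩, hu.2⟩
  have h := tendsto_iff_dist_tendsto_zero.1 hlim
  exact ⟨u', φ, hφ, tendsto_iff_dist_tendsto_zero.2 h⟩

/-- Near minimizers along `ε = 1/(2k)` with controlled Lipschitz constant. -/
theorem exists_near_minimizer_even {Ω : Set (Euc d)} (ho : IsOpen Ω) (hc : Ω ⊆ unitCube d)
    {β : ℝ} (hβ : 1 < β) (hΩ : BoundaryCheaper Ω β) (h0 : (0 : Euc d) ∈ whiteSet Ω) (p : ℝ≥0∞)
    (k : ℕ) {δ : ℝ} (hδ : 0 < δ) :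
    ∃ u : CurveSpace (0 : Euc d) (cubeCentre d),
      LipschitzWith (Real.toNNReal (diagDist Ω β (k + 1) / ((k : ℝ) + 1) / 2 + δ)) u.1 ∧
      lengthFunctional Ω β p (1 / (2 * ((k : ℝ) + 1))) u ≤
        ENNReal.ofReal (diagDist Ω β (k + 1) / ((k : ℝ) + 1) / 2 + δ) := by
  set ε : ℝ := 1 / (2 * ((k : ℝ) + 1)) with hε
  have hε0 : 0 < ε := by positivity
  have hs := diagDist_nonneg Ω β (k + 1)
  set r : ℝ := diagDist Ω β (k + 1) / ((k : ℝ) + 1) / 2 + δ with hr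
  have hrε : ε⁻¹ * r = diagDist Ω β (k + 1) + ε⁻¹ * δ := by
    rw [hr, hε]; field_simp
  have hlt : weightDist (blackWeight Ω (ENNReal.ofReal β)) 0 (diagVec d (k + 1)) <
      ENNReal.ofReal (ε⁻¹ * r) := by
    rw [← ofReal_diagDist hβ.le, hrε]
    have : 0 < ε⁻¹ * δ := by positivity
    exact (ENNReal.ofReal_lt_ofReal_iff (by linarith)).2 (by linarith)
  obtain ⟨v, hv⟩ := iInf_lt_iff.1 hlt
  -- Passing to a white curve makes the bound independent of `p` and turns the cost bound into a
  -- Lipschitz bound.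
  obtain ⟨g, g1, g2, g3, g4⟩ :=
    exists_white_curve ho hc hβ hΩ h0 (diagVec_mem_whiteSet h0 _) v
  have g1' : LipschitzWith (Real.toNNReal (ε⁻¹ * r)) g :=
    g1.weaken (ENNReal.toNNReal_mono ENNReal.ofReal_ne_top hv.le)
  have hL : LipschitzWith (Real.toNNReal r) (fun τ => ε • g τ) := by
    have := (lipschitzWith_smul (β := Euc d) ε).comp g1'
    have e : ‖ε‖₊ * Real.toNNReal (ε⁻¹ * r) = Real.toNNReal r := by
      rw [← Real.toNNReal_eq_nnnorm_of_nonneg hε0.le, ← Real.toNNReal_mul hε0.le,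
        mul_inv_cancel_left₀ hε0.ne']
    rwa [e] at this
  have hend : ε • g 1 = cubeCentre d := by
    rw [g3, ← smul_cubeCentre_even, ← hε, smul_inv_smul₀ hε0.ne']
  refine ⟨CurveSpace.ofLipschitz _ ⟨_, hL⟩ (by simp [g2]) hend, fun s t => hL s t, ?_⟩
  rw [lengthFunctional, weightedLength_ofLipschitz]
  refine (arcCost_le_of_lipschitz hL (t := 1) fun τ _ => ?_).trans ?_
  · rw [inv_smul_smul₀ hε0.ne', metricCoeff_eq, blackWeight_of_mem_whiteSet (g4 τ)]
  · simp [ENNReal.ofReal]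

theorem tendsto_even_eps :
    Tendsto (fun k : ℕ => 1 / (2 * ((k : ℝ) + 1))) atTop (𝓝 0) := by
  refine squeeze_zero (fun k => by positivity) (fun k => ?_) tendsto_one_div_add_atTop_nhds_zero_nat
  gcongr
  linarith [k.cast_nonneg (α := ℝ)]

/-- A `Γ`-limit is bounded below by the limit of the infima. -/
theorem le_of_seqGammaConverges {X : Type*} [MetricSpace X] {F : ℕ → X → ℝ≥0∞} {G : X → ℝ≥0∞}
    (h : SeqGammaConverges F G) {L : ℝ≥0∞} (hL : Tendsto (fun k => ⨅ v, F k v) atTop (𝓝 L))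
    (u : X) : L ≤ G u := by
  obtain ⟨v, -, hv⟩ := (h u).2
  rw [← hL.limsup_eq]
  exact (limsup_le_limsup (Eventually.of_forall fun k => iInf_le _ (v k))).trans hv

end

/-! ### Separation of the two limits and failure of `Γ`-convergence -/

theorem theorem5p7 {d : ℕ} (Ω : Set (Euc d)) (hΩ : IsAdmissibleInclusion Ω)
    (lam β : ℝ) (hlam : IsHighOpacityCoefficient Ω lam) (hβ : lam < β)
    (p : ℝ≥0∞) (hp : 1 ≤ p)
    (hcentre : cubeCentre d ∈ Ω) (horigin : (0 : Euc d) ∈ whiteSet Ω) :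
    (¬ ∃ L : ℝ≥0∞,
      Tendsto (fun ε : ℝ => inducedDist Ω β p ε 0 (cubeCentre d)) (𝓝[>] 0) (𝓝 L)) ∧
    (∃ M L : ℝ≥0∞, M < L ∧
      Tendsto (fun k : ℕ => inducedDist Ω β p (1 / (2 * ((k : ℝ) + 1))) 0 (cubeCentre d))
        atTop (𝓝 M) ∧
      Tendsto (fun k : ℕ => inducedDist Ω β p (1 / (2 * ((k : ℝ) + 1) + 1)) 0 (cubeCentre d))
        atTop (𝓝 L)) ∧
    (¬ ∃ G : CurveSpace (0 : Euc d) (cubeCentre d) → ℝ≥0∞,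
      GammaConvergesAtZero
        (fun (ε : ℝ) (u : CurveSpace (0 : Euc d) (cubeCentre d)) => lengthFunctional Ω β p ε u)
        G) := by
  have ho := hΩ.isOpen
  have hc := hΩ.ssubset_unitCube.subset
  have hfr := hΩ.isPathConnected_frontier.nonempty
  have hB : BoundaryCheaper Ω β := fun x hx y hy hxy => hlam.2 x hx y hy hxy β hβ
  have hβ1 := one_lt_of_boundaryCheaper ho hc hΩ.nonempty hfr hB
  obtain ⟨q, hq, hmin⟩ := exists_nearest_frontier hc hfr (cubeCentre d)
  have hρ : 0 < ‖cubeCentre d - q‖ := by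
    rw [norm_pos_iff, sub_ne_zero]
    rintro h
    rw [ho.frontier_eq, ← h] at hq
    exact hq.2 hcentre
  obtain ⟨m, hm0, hm⟩ := exists_tendsto_diagDist Ω hβ1.le
  have hM := tendsto_inducedDist_even ho hc hβ1 hB horigin p hm
  obtain ⟨L, hML, hL⟩ : ∃ L : ℝ≥0∞, ENNReal.ofReal (m / 2) < L ∧
      Tendsto (fun k : ℕ => inducedDist Ω β p (1 / (2 * ((k : ℝ) + 1) + 1)) 0 (cubeCentre d))
        atTop (𝓝 L) := by
    rcases hp.eq_or_lt with rfl | hp1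
    · refine ⟨_, ?_, tendsto_inducedDist_odd_one ho hc hβ1 hB horigin hcentre hq hmin hm⟩
      have : 0 < β * ‖cubeCentre d - q‖ := by positivity
      exact (ENNReal.ofReal_lt_ofReal_iff (by linarith)).2 (by linarith)
    · exact ⟨⊤, ENNReal.ofReal_lt_top,
        tendsto_inducedDist_odd_top ho hc hβ1 horigin hcentre hρ hmin hp1⟩
  have heven : ∀ k : ℕ, 0 < 1 / (2 * ((k : ℝ) + 1)) := fun k => by positivity
  have hodd : ∀ k : ℕ, 0 < 1 / (2 * ((k : ℝ) + 1) + 1) := fun k => by positivity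
  refine ⟨?_, ⟨_, L, hML, hM, hL⟩, ?_⟩
  · rintro ⟨A, hA⟩
    have hA1 := tendsto_nhds_unique hM (hA.comp (tendsto_nhdsWithin_iff.2
      ⟨tendsto_even_eps, Eventually.of_forall heven⟩))
    have hA2 := tendsto_nhds_unique hL (hA.comp (tendsto_nhdsWithin_iff.2
      ⟨tendsto_odd_eps, Eventually.of_forall hodd⟩))
    exact hML.ne (hA1.trans hA2.symm)
  · rintro ⟨G, hG⟩
    have hGL : ∀ u, L ≤ G u := le_of_seqGammaConverges (hG _ hodd tendsto_odd_eps) hL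
    -- The excess `1/(k+1)` tends to zero, so energies and Lipschitz constants have bounds tending
    -- to `m/2`; in particular the constants are bounded, which yields the compactness.
    choose v hv1 hv2 using fun k : ℕ => exists_near_minimizer_even ho hc hβ1 hB horigin p k
      (Nat.one_div_pos_of_nat (α := ℝ) (n := k))
    have hlim : Tendsto (fun k : ℕ => diagDist Ω β (k + 1) / ((k : ℝ) + 1) / 2 +
        1 / ((k : ℝ) + 1)) atTop (𝓝 (m / 2)) := by
      simpa using (hm.div_const 2).add tendsto_one_div_add_atTop_nhds_zero_nat
    obtain ⟨C, hC⟩ := hlim.bddAbove_range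
    obtain ⟨u, φ, hφ, hu⟩ := CurveSpace.exists_tendsto_subseq (C := Real.toNNReal C) v
      fun k => (hv1 k).weaken (Real.toNNReal_le_toNNReal (hC ⟨k, rfl⟩))
    -- The hypothesis on `G` covers every null sequence, hence also the extracted subsequence.
    have hle := ((hG (fun k => 1 / (2 * ((φ k : ℝ) + 1))) (fun k => heven _)
      (tendsto_even_eps.comp hφ.tendsto_atTop)) u).1 _ hu
    have hle' := hle.trans (liminf_le_liminf (Eventually.of_forall fun k => hv2 (φ k)))
    have hlim' := ((ENNReal.tendsto_ofReal hlim).comp hφ.tendsto_atTop).liminf_eq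
    exact absurd ((hGL u).trans (hle'.trans hlim'.le)) (not_le.2 hML)
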